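/- **Setting.** Let $\alpha>0$, let $V(x)=\sum_{j=0}^m q_jx^j$ be a real polynomial of degree $m\ge1$ with $q_m>0$, and put $w(x)=x^\alpha e^{-V(x)}$ on $\mathbb R_+=(0,\infty)$. Write $\langle f,h\rangle=\int_0^\infty fh\,dx$ and $(\varepsilon f)(x)=\frac12\int_0^\infty\operatorname{sgn}(x-y)f(y)\,dy$; both act entrywise on vectors of functions. Let $p_k(x)=\gamma_kx^k+\dots$, $\gamma_k>0$, be the orthonormal polynomials for $w$ on $\mathbb R_+$, $\phi_k=p_k\sqrt w$, $K_n(x,y)=\sum_{k=0}^{n-1}\phi_k(x)\phi_k(y)$, $K$ the integral operator on $\mathbb R_+$ with kernel $K_n$, and $D$ differentiation. Let $n$ be an even integer with $n\ge m$. *The kernels.* Let $(r_k)_{k\ge0}$ be any sequence of real polynomials with $\deg r_k=k$, and $\psi_k=r_k\sqrt w$. Put $M_{n,1}=(\langle\psi_j,\varepsilon\psi_k\rangle)_{0\le j,k\le n-1}$ and $M_{\frac n2,4}=(\langle\psi_j,\psi_k'\rangle)_{0\le j,k\le n-1}$; these matrices are invertible. Define $$S_{n,1}(x,y)=-\sum_{j,k=0}^{n-1}\psi_j(x)\,(M_{n,1}^{-1})_{jk}\,(\varepsilon\psi_k)(y),\qquad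 S_{\frac n2,4}(x,y)=\sum_{j,k=0}^{n-1}\psi_j'(x)\,(M_{\frac n2,4}^{-1})_{jk}\,\psi_k(y).$$ *The functions $\Phi$.* Let $\beta_n>0$ and $d_n<0$ be any real numbers (normalizing constants). Put $$\tilde\psi_1(x)=\tfrac{\gamma_{n-1}}{\gamma_n}\Big[p_{n-1}(0)\tfrac{\phi_n(x)}x-p_n(0)\tfrac{\phi_{n-1}(x)}x\Big],\qquad \tilde\psi_2(x)=\tfrac{\gamma_{n-1}}{\gamma_n}\Big[c_{n-1}\tfrac{\phi_n(x)}x-c_n\tfrac{\phi_{n-1}(x)}x\Big],\qquad c_k=\int_0^\infty\frac{p_k(y)w(y)}y\,dy,$$ and let, to be distinguished from the $\psi_k$ above, $\Psi_1=\alpha d_n\sqrt{\beta_n/n}\,\tilde\psi_1$ and $\Psi_2=d_n^{-1}\sqrt{\beta_n/n}\,\tilde\psi_2$. Let $\Phi=(\Phi_1,\Phi_2)$ be the row vector with $$\Phi_1=(\phi_{n-1},\phi_{n-2},\dots,\phi_{n-m+1},\Psi_1),\qquad \Phi_2=(\phi_n,\phi_{n+1},\dots,\phi_{n+m-2},\Psi_2).$$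 *The matrices.* There is a unique real $2m\times2m$ matrix $A$ with $$(DK-KD)f=\Phi A\langle f,\Phi^t\rangle\quad\text{on }\mathbb R_+,\qquad\text{for all }f\in C^1(\mathbb R_+)\text{ with }f'\in L^1(\mathbb R_+),$$ and in $m\times m$ blocks $A=\begin{pmatrix}0&A_{12}\\A_{21}&0\end{pmatrix}$ with $A_{12}=A_{21}^t$. Put $$B=\langle\varepsilon\Phi^t,\Phi\rangle=\begin{pmatrix}B_{11}&B_{12}\\B_{21}&B_{22}\end{pmatrix},\qquad C=\begin{pmatrix}I&0\\0&0\end{pmatrix}+BA=\begin{pmatrix}C_{11}&C_{12}\\C_{21}&C_{22}\end{pmatrix},\qquad \widehat C_{22}=I-C_{22}.$$ The matrices $C_{11}$ and $\widehat C_{22}$ are invertible; put $$G_{11}=A_{21}C_{11}^{-1}C_{12},\qquad \widehat G_{11}=-A_{12}B_{22}\widehat C_{22}^{-t}A_{21}.$$ **Lemma.** (i) For all $x,y>0$, $$S_{\frac n2,4}(x,y)=K_n(x,y)-\Phi_2(x)A_{21}\,\varepsilon\Phi_1(y)^t-\Phi_2(x)G_{11}\,\varepsilon\Phi_2(y)^t,$$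 $$S_{n,1}(x,y)=K_n(x,y)-\Phi_1(x)A_{12}\,\varepsilon\Phi_2(y)^t-\Phi_1(x)\widehat G_{11}\,\varepsilon\Phi_1(y)^t.$$ (ii) $G_{11}$ and $\widehat G_{11}$ are skew-symmetric, and $\widehat G_{11}=-A_{12}\widehat C_{22}^{-1}C_{21}$. The existence, uniqueness and block form of $A$ and the invertibility of $M_{n,1}$, $M_{\frac n2,4}$, $C_{11}$ and $\widehat C_{22}$ are part of the assertion. -/

import Mathlib

open MeasureTheory Set Polynomial

namespace LaguerreWidom

noncomputable section

/-! Throughout, functions on `ℝ₊ = (0, ∞)` are represented by functions `ℝ → ℝ`; only their values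
on `(0, ∞)` are used. -/

/-- The weight `w(x) = x ^ α * exp (-V(x))`. -/
def weight (α : ℝ) (V : ℝ[X]) (x : ℝ) : ℝ := x ^ α * Real.exp (-V.eval x)

/-- The real inner product `⟨f, h⟩ = ∫₀^∞ f h`. -/
def ip (f h : ℝ → ℝ) : ℝ := ∫ x in Ioi (0 : ℝ), f x * h x

/-- `(ε f)(x) = ½ ∫₀^∞ sgn(x - y) f(y) dy`. -/
def eps (f : ℝ → ℝ) (x : ℝ) : ℝ := ∫ y in Ioi (0 : ℝ), (1 / 2) * Real.sign (x - y) * f y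

/-- The inner product `∫₀^∞ q r w` of two polynomials. -/
def wip (α : ℝ) (V q r : ℝ[X]) : ℝ := ∫ x in Ioi (0 : ℝ), q.eval x * r.eval x * weight α V x

/-- The monic orthogonal polynomials for the weight `w`, by the Gram-Schmidt procedure. -/
def monicOP (α : ℝ) (V : ℝ[X]) : ℕ → ℝ[X]
  | k => X ^ k - ∑ j : Fin k,
      C (wip α V (X ^ k) (monicOP α V j) / wip α V (monicOP α V j) (monicOP α V j)) * monicOP α V j
  decreasing_by all_goals exact j.2

/-- The orthonormal polynomials `p_k` for the weight `w`, with positive leading coefficient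
(see `orthoPoly_spec` for the defining properties). -/
def orthoPoly (α : ℝ) (V : ℝ[X]) (k : ℕ) : ℝ[X] :=
  C (1 / Real.sqrt (wip α V (monicOP α V k) (monicOP α V k))) * monicOP α V k

/-- For a polynomial `q`, the function `q √w`. -/
def withWeight (α : ℝ) (V q : ℝ[X]) (x : ℝ) : ℝ := q.eval x * Real.sqrt (weight α V x)

/-- `φ_k = p_k √w`. -/
def phi (α : ℝ) (V : ℝ[X]) (k : ℕ) : ℝ → ℝ := withWeight α V (orthoPoly α V k)

/-- The Christoffel-Darboux kernel `K_n(x, y) = ∑_{k < n} φ_k(x) φ_k(y)`. -/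
def kernelK (α : ℝ) (V : ℝ[X]) (n : ℕ) (x y : ℝ) : ℝ :=
  ∑ k ∈ Finset.range n, phi α V k x * phi α V k y

/-- The operator with kernel `K_n`, the orthogonal projection onto `span (φ_0, …, φ_{n-1})`. -/
def opK (α : ℝ) (V : ℝ[X]) (n : ℕ) (f : ℝ → ℝ) (x : ℝ) : ℝ :=
  ∫ y in Ioi (0 : ℝ), kernelK α V n x y * f y

/-! ### The kernels `S_{n,1}` and `S_{n,4}`

In terms of `w = w_1 ^ 2 = w_4`, the functions `ψ_{k,1} = r_k w_1` and `ψ_{k,4} = r_k w_4 ^ (1/2)`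
are both equal to `r_k √w`. -/

/-- The `n × n` matrix `⟨ψ_j, ε ψ_k⟩`. -/
def matM1 (α : ℝ) (V : ℝ[X]) (r : ℕ → ℝ[X]) (n : ℕ) : Matrix (Fin n) (Fin n) ℝ :=
  Matrix.of fun j k => ip (withWeight α V (r j)) (eps (withWeight α V (r k)))

/-- The `2N × 2N` matrix `⟨ψ_j, ψ_k'⟩`. -/
def matM4 (α : ℝ) (V : ℝ[X]) (r : ℕ → ℝ[X]) (N : ℕ) : Matrix (Fin (2 * N)) (Fin (2 * N)) ℝ :=
  Matrix.of fun j k => ip (withWeight α V (r j)) (deriv (withWeight α V (r k)))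

/-- `S_{n,1}(x, y) = - ∑_{j,k < n} ψ_j(x) (M_{n,1}⁻¹)_{jk} (ε ψ_k)(y)`. -/
def kernelS1 (α : ℝ) (V : ℝ[X]) (r : ℕ → ℝ[X]) (n : ℕ) (x y : ℝ) : ℝ :=
  -∑ j : Fin n, ∑ k : Fin n,
    withWeight α V (r j) x * (matM1 α V r n)⁻¹ j k * eps (withWeight α V (r k)) y

/-- `S_{N,4}(x, y) = ∑_{j,k < 2N} ψ_j'(x) (M_{N,4}⁻¹)_{jk} ψ_k(y)`. -/
def kernelS4 (α : ℝ) (V : ℝ[X]) (r : ℕ → ℝ[X]) (N : ℕ) (x y : ℝ) : ℝ :=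
  ∑ j : Fin (2 * N), ∑ k : Fin (2 * N),
    deriv (withWeight α V (r j)) x * (matM4 α V r N)⁻¹ j k * withWeight α V (r k) y

/-! ### The functions `Φ` and the matrices `A`, `B`, `C`

`m` is the degree of `V`; `b > 0` and `d < 0` are the normalizing constants `β_n` and `d_n`. -/

/-- `γ_{n-1} / γ_n`, with `γ_k` the leading coefficient of `p_k`. -/
def gammaRatio (α : ℝ) (V : ℝ[X]) (n : ℕ) : ℝ :=
  (orthoPoly α V (n - 1)).leadingCoeff / (orthoPoly α V n).leadingCoeff

/-- `2 π i C(p_k w)(0) = ∫₀^∞ p_k(y) w(y) / y dy`, where `C` is the Cauchy transform. -/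
def cauchyZero (α : ℝ) (V : ℝ[X]) (k : ℕ) : ℝ :=
  ∫ y in Ioi (0 : ℝ), (orthoPoly α V k).eval y * weight α V y / y

def psiTilde1 (α : ℝ) (V : ℝ[X]) (n : ℕ) (x : ℝ) : ℝ :=
  gammaRatio α V n * ((orthoPoly α V (n - 1)).eval 0 * (phi α V n x / x)
    - (orthoPoly α V n).eval 0 * (phi α V (n - 1) x / x))

def psiTilde2 (α : ℝ) (V : ℝ[X]) (n : ℕ) (x : ℝ) : ℝ :=
  gammaRatio α V n * (cauchyZero α V (n - 1) * (phi α V n x / x)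
    - cauchyZero α V n * (phi α V (n - 1) x / x))

def psi1 (α : ℝ) (V : ℝ[X]) (b d : ℝ) (n : ℕ) (x : ℝ) : ℝ :=
  α * d * Real.sqrt (b / n) * psiTilde1 α V n x

def psi2 (α : ℝ) (V : ℝ[X]) (b d : ℝ) (n : ℕ) (x : ℝ) : ℝ :=
  1 / d * Real.sqrt (b / n) * psiTilde2 α V n x

/-- `Φ_1 = (φ_{n-1}, φ_{n-2}, …, φ_{n-m+1}, ψ_1)`. -/
def Phi1 (α : ℝ) (V : ℝ[X]) (b d : ℝ) (n : ℕ) (i : Fin V.natDegree) : ℝ → ℝ :=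
  if (i : ℕ) + 1 < V.natDegree then phi α V (n - 1 - i) else psi1 α V b d n

/-- `Φ_2 = (φ_n, φ_{n+1}, …, φ_{n+m-2}, ψ_2)`. -/
def Phi2 (α : ℝ) (V : ℝ[X]) (b d : ℝ) (n : ℕ) (i : Fin V.natDegree) : ℝ → ℝ :=
  if (i : ℕ) + 1 < V.natDegree then phi α V (n + i) else psi2 α V b d n

/-- The row vector `Φ = (Φ_1, Φ_2)` of length `2m`. -/
def Phi (α : ℝ) (V : ℝ[X]) (b d : ℝ) (n : ℕ) : Fin V.natDegree ⊕ Fin V.natDegree → ℝ → ℝ :=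
  Sum.elim (Phi1 α V b d n) (Phi2 α V b d n)

/-- `2m × 2m` matrices, written in `m × m` blocks. -/
abbrev BlockMat (m : ℕ) := Matrix (Fin m ⊕ Fin m) (Fin m ⊕ Fin m) ℝ

/-- `A` represents the commutator of differentiation `D` and the projection `K`:
`[D, K] f = Φ A ⟨f, Φᵗ⟩` for all `f ∈ C¹(ℝ₊)` with `f' ∈ L¹(ℝ₊)`. -/
def IsCommutatorMatrix (α : ℝ) (V : ℝ[X]) (b d : ℝ) (n : ℕ) (A : BlockMat V.natDegree) : Prop :=
  ∀ f : ℝ → ℝ, ContDiffOn ℝ 1 f (Ioi 0) → IntegrableOn (deriv f) (Ioi 0) →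
    ∀ x : ℝ, 0 < x →
      deriv (opK α V n f) x - opK α V n (deriv f) x =
        ∑ i, ∑ j, Phi α V b d n i x * A i j * ip f (Phi α V b d n j)

/-- `B = ⟨ε Φᵗ, Φ⟩`. -/
def matB (α : ℝ) (V : ℝ[X]) (b d : ℝ) (n : ℕ) : BlockMat V.natDegree :=
  Matrix.of fun i j => ip (eps (Phi α V b d n i)) (Phi α V b d n j)

/-- `C = (I 0; 0 0) + B A`. -/
def matC (α : ℝ) (V : ℝ[X]) (b d : ℝ) (n : ℕ) (A : BlockMat V.natDegree) :
    BlockMat V.natDegree :=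
  Matrix.fromBlocks 1 0 0 0 + matB α V b d n * A

/-- `Ĉ₂₂ = I - C₂₂`. -/
def matCHat22 (α : ℝ) (V : ℝ[X]) (b d : ℝ) (n : ℕ) (A : BlockMat V.natDegree) :
    Matrix (Fin V.natDegree) (Fin V.natDegree) ℝ :=
  1 - (matC α V b d n A).toBlocks₂₂

/-- `G₁₁ = A₂₁ C₁₁⁻¹ C₁₂`. -/
def matG11 (α : ℝ) (V : ℝ[X]) (b d : ℝ) (n : ℕ) (A : BlockMat V.natDegree) :
    Matrix (Fin V.natDegree) (Fin V.natDegree) ℝ :=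
  A.toBlocks₂₁ * ((matC α V b d n A).toBlocks₁₁)⁻¹ * (matC α V b d n A).toBlocks₁₂

/-- `Ĝ₁₁ = - A₁₂ B₂₂ Ĉ₂₂^{-t} A₂₁`. -/
def matGHat11 (α : ℝ) (V : ℝ[X]) (b d : ℝ) (n : ℕ) (A : BlockMat V.natDegree) :
    Matrix (Fin V.natDegree) (Fin V.natDegree) ℝ :=
  -(A.toBlocks₁₂ * (matB α V b d n).toBlocks₂₂ * ((matCHat22 α V b d n A)⁻¹).transpose
    * A.toBlocks₂₁)

/-- For a row vector `F`, a matrix `T` and a row vector `H`, the function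
`F(x) T (ε H)(y)ᵗ` of `(x, y)`. -/
def sandwich {m : ℕ} (F : Fin m → ℝ → ℝ) (T : Matrix (Fin m) (Fin m) ℝ) (H : Fin m → ℝ → ℝ)
    (x y : ℝ) : ℝ :=
  ∑ i, ∑ j, F i x * T i j * eps (H j) y

/-! ### The defining properties of the orthonormal polynomials -/

theorem continuous_poly_weight {α : ℝ} (hα : 0 < α) (V q : ℝ[X]) :
    Continuous fun x => q.eval x * weight α V x := by
  unfold weight
  have h1 : Continuous fun x : ℝ => x ^ α :=
    continuous_id.rpow_const fun _ => Or.inr hα.le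
  have h2 : Continuous fun x : ℝ => V.eval x := V.continuous
  have h3 : Continuous fun x : ℝ => q.eval x := q.continuous
  fun_prop

theorem integrable_poly_weight {α : ℝ} {V : ℝ[X]} (hα : 0 < α) (hm : 0 < V.natDegree)
    (hV : 0 < V.leadingCoeff) (q : ℝ[X]) :
    IntegrableOn (fun x => q.eval x * weight α V x) (Ioi 0) := by
  set c := V.leadingCoeff / 2 with hc
  have hc0 : 0 < c := by positivity
  refine integrable_of_isBigO_exp_neg (b := c / 2) (by positivity)
    (continuous_poly_weight hα V q).continuousOn ?_
  have hVx : ∀ᶠ x : ℝ in Filter.atTop, c * x ≤ V.eval x := by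
    have h := V.isEquivalent_atTop_lead
    have h' := h.isLittleO.bound (c := 1 / 2) (by norm_num)
    filter_upwards [h', Filter.eventually_ge_atTop 1] with x hx hx1
    have hxm : x ≤ x ^ V.natDegree := le_self_pow₀ hx1 hm.ne'
    have hpos : 0 ≤ V.leadingCoeff * x ^ V.natDegree := by positivity
    simp only [Pi.sub_apply, Real.norm_eq_abs, abs_of_nonneg hpos] at hx
    have := (abs_le.1 hx).1
    have : V.leadingCoeff * x ≤ V.leadingCoeff * x ^ V.natDegree := by gcongr
    rw [hc]; linarith
  have hq : (fun x => q.eval x) =O[Filter.atTop] fun x : ℝ => x ^ (q.natDegree : ℝ) := by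
    refine q.isEquivalent_atTop_lead.isBigO.trans ?_
    simp only [Real.rpow_natCast]
    exact Asymptotics.isBigO_const_mul_self _ _ _
  have hqa : (fun x => q.eval x * x ^ α) =O[Filter.atTop] fun x : ℝ => Real.exp (c / 2 * x) := by
    refine Asymptotics.IsBigO.trans (g := fun x : ℝ => x ^ ((q.natDegree : ℝ) + α)) ?_
      (isLittleO_rpow_exp_pos_mul_atTop _ (by positivity)).isBigO
    refine (hq.mul (Asymptotics.isBigO_refl (fun x : ℝ => x ^ α) _)).congr' .rfl ?_
    filter_upwards [Filter.eventually_gt_atTop 0] with x hx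
    rw [Real.rpow_add hx]
  have he : (fun x => Real.exp (-V.eval x)) =O[Filter.atTop] fun x : ℝ => Real.exp (-c * x) := by
    refine Asymptotics.IsBigO.of_bound 1 ?_
    filter_upwards [hVx] with x hx
    rw [Real.norm_of_nonneg (Real.exp_pos _).le, Real.norm_of_nonneg (Real.exp_pos _).le, one_mul]
    exact Real.exp_le_exp.2 (by linarith)
  refine (hqa.mul he).congr (fun x => ?_) fun x => ?_
  · simp only [weight]; ring
  · rw [← Real.exp_add]; congr 1; ring

theorem integrable_wip {α : ℝ} {V : ℝ[X]} (hα : 0 < α) (hm : 0 < V.natDegree)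
    (hV : 0 < V.leadingCoeff) (q r : ℝ[X]) :
    IntegrableOn (fun x => q.eval x * r.eval x * weight α V x) (Ioi 0) := by
  simpa using integrable_poly_weight hα hm hV (q * r)

theorem wip_comm (α : ℝ) (V q r : ℝ[X]) : wip α V q r = wip α V r q := by
  simp only [wip, mul_comm (eval _ q)]

theorem wip_C_mul (α : ℝ) (V q r : ℝ[X]) (c : ℝ) : wip α V (C c * q) r = c * wip α V q r := by
  simp only [wip, ← integral_const_mul, eval_mul, eval_C, mul_assoc]

theorem wip_sub_sum {α : ℝ} {V : ℝ[X]} (hα : 0 < α) (hm : 0 < V.natDegree)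
    (hV : 0 < V.leadingCoeff) {ι : Type*} (s : Finset ι) (q r : ℝ[X]) (u : ι → ℝ[X]) :
    wip α V (q - ∑ i ∈ s, u i) r = wip α V q r - ∑ i ∈ s, wip α V (u i) r := by
  unfold wip
  rw [← integral_finsetSum _ fun i _ => integrable_wip hα hm hV (u i) r,
    ← integral_sub (integrable_wip hα hm hV q r)
      (integrable_finsetSum _ fun i _ => integrable_wip hα hm hV (u i) r)]
  congr 1; ext x
  simp only [eval_sub, eval_finsetSum, sub_mul, Finset.sum_mul]

theorem wip_self_pos {α : ℝ} {V : ℝ[X]} (hα : 0 < α) (hm : 0 < V.natDegree)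
    (hV : 0 < V.leadingCoeff) {q : ℝ[X]} (hq : q ≠ 0) : 0 < wip α V q q := by
  have hw : ∀ x : ℝ, 0 < x → 0 < weight α V x := fun x hx => by unfold weight; positivity
  have hnn : ∀ x : ℝ, 0 < x → 0 ≤ q.eval x * q.eval x * weight α V x := fun x hx =>
    mul_nonneg (mul_self_nonneg _) (hw x hx).le
  unfold wip
  rw [setIntegral_pos_iff_support_of_nonneg_ae
    ((ae_restrict_iff' measurableSet_Ioi).2 (.of_forall hnn)) (integrable_wip hα hm hV q q)]
  have hsub : Ioi (0 : ℝ) \ (q.roots.toFinset : Set ℝ) ⊆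
      Function.support (fun x => q.eval x * q.eval x * weight α V x) ∩ Ioi 0 := by
    rintro x ⟨hx, hxr⟩
    have h0 : q.eval x ≠ 0 := fun h => hxr (by simp [hq, h])
    exact ⟨mul_ne_zero (mul_ne_zero h0 h0) (hw x hx).ne', hx⟩
  refine lt_of_lt_of_le ?_ (measure_mono hsub)
  rw [measure_sdiff_null ((Finset.finite_toSet _).measure_zero _)]
  simp

theorem monicOP_spec (α : ℝ) (V : ℝ[X]) (k : ℕ) :
    (monicOP α V k).Monic ∧ (monicOP α V k).natDegree = k := by
  induction k using Nat.strong_induction_on with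
  | _ k ih =>
    have hlt : (∑ j : Fin k, C (wip α V (X ^ k) (monicOP α V j) /
        wip α V (monicOP α V j) (monicOP α V j)) * monicOP α V j).degree < ((X : ℝ[X]) ^ k).degree := by
      rw [degree_X_pow]
      refine mem_degreeLT.1 (Submodule.sum_mem _ fun j _ => mem_degreeLT.2 ?_)
      rw [← smul_eq_C_mul]
      refine (degree_smul_le _ _).trans_lt ?_
      rw [degree_eq_natDegree (ih j j.2).1.ne_zero, (ih j j.2).2]
      exact_mod_cast j.2
    rw [monicOP]
    refine ⟨(monic_X_pow k).sub_of_left hlt, ?_⟩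
    rw [natDegree_eq_of_degree_eq (degree_sub_eq_left_of_degree_lt hlt), natDegree_X_pow]

theorem wip_monicOP {α : ℝ} {V : ℝ[X]} (hα : 0 < α) (hm : 0 < V.natDegree)
    (hV : 0 < V.leadingCoeff) (k : ℕ) :
    ∀ l < k, wip α V (monicOP α V k) (monicOP α V l) = 0 := by
  induction k using Nat.strong_induction_on with
  | _ k ih =>
    intro l hl
    rw [monicOP, wip_sub_sum hα hm hV, Finset.sum_eq_single (⟨l, hl⟩ : Fin k), wip_C_mul,
      div_mul_cancel₀ _ (wip_self_pos hα hm hV (monicOP_spec α V l).1.ne_zero).ne', sub_self]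
    · intro j _ hj
      have hne : (j : ℕ) ≠ l := fun h => hj (Fin.ext h)
      rw [wip_C_mul]
      rcases lt_or_gt_of_ne hne with h | h
      · rw [wip_comm α V (monicOP α V j) (monicOP α V l), ih l hl j h, mul_zero]
      · rw [ih j j.2 l h, mul_zero]
    · simp

/-- `p_k` has degree `k` and positive leading coefficient, and `∫₀^∞ p_k p_l w = δ_{kl}`. -/
theorem orthoPoly_spec {α : ℝ} {V : ℝ[X]} (hα : 0 < α) (hm : 0 < V.natDegree)
    (hV : 0 < V.leadingCoeff) (k l : ℕ) :
    (orthoPoly α V k).natDegree = k ∧ 0 < (orthoPoly α V k).leadingCoeff ∧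
      ∫ x in Ioi (0 : ℝ), (orthoPoly α V k).eval x * (orthoPoly α V l).eval x * weight α V x =
        if k = l then 1 else 0 := by
  have hpos : ∀ j, 0 < wip α V (monicOP α V j) (monicOP α V j) := fun j =>
    wip_self_pos hα hm hV (monicOP_spec α V j).1.ne_zero
  have hs : 0 < 1 / Real.sqrt (wip α V (monicOP α V k) (monicOP α V k)) :=
    one_div_pos.2 (Real.sqrt_pos.2 (hpos k))
  refine ⟨?_, ?_, ?_⟩
  · rw [orthoPoly, natDegree_C_mul hs.ne', (monicOP_spec α V k).2]
  · rw [orthoPoly, leadingCoeff_mul, leadingCoeff_C, (monicOP_spec α V k).1.leadingCoeff, mul_one]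
    exact hs
  · change wip α V (orthoPoly α V k) (orthoPoly α V l) = _
    rw [orthoPoly, orthoPoly, wip_C_mul, wip_comm α V _ (C _ * _), wip_C_mul]
    split_ifs with h
    · subst h
      have h2 := Real.mul_self_sqrt (hpos k).le
      have h3 := (Real.sqrt_pos.2 (hpos k)).ne'
      field_simp
      rw [sq, h2]
    · rcases lt_or_gt_of_ne h with h | h
      · rw [wip_monicOP hα hm hV l k h]; simp
      · rw [wip_comm α V (monicOP α V l) (monicOP α V k), wip_monicOP hα hm hV k l h]; simp

end

end LaguerreWidom

/-! Every function that occurs, except the images under $\varepsilon$, has the form $q\sqrt w/x$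
with $q$ a polynomial. Let $L(q)=\int_0^\infty q\,w/x$ (`Admissible.moment`), and let $\delta$
(`polyDeriv`) be the map with $(q\sqrt w)'=(\delta q)\sqrt w/x$. Since $q\sqrt w$ vanishes at $0$
and $\infty$, $\varepsilon$ inverts $D$ on these functions. Hence the antisymmetric form
$\langle\varepsilon\,\cdot,\cdot\rangle$ satisfies $\langle\varepsilon(\delta q),r\rangle=L(qr)$
(`Admissible.epsForm_polyDeriv`), and $L(\delta q\cdot r)$ is antisymmetric in $q,r$. All that
follows is linear algebra over polynomials, plus two nondegeneracy statements.

Commutator. By Christoffel-Darboux, $\tilde\psi_1$ is $K_n(\cdot,0)$ without its factor $\sqrt w$ at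
$0$, so $K\Phi_1=\Phi_1$; and $\tilde\psi_2=(x\sum_{k<n}c_kp_k-1)\sqrt w/x$, so $K\Phi_2=0$. Each
$\delta p_k$, $k<n$, is $x$ times a polynomial of degree $<n$ plus a combination of $\Phi_2$. The
first parts cancel in $(\partial_x+\partial_y)K_n$ by antisymmetry; the second give the off-diagonal
blocks of $A$. Uniqueness is the linear independence of the entries of $\Phi$.

Nondegeneracy. For even $n$ the forms $\langle q\sqrt w,(r\sqrt w)'\rangle$ and
$\langle\varepsilon(q\sqrt w),r\sqrt w\rangle$ are nondegenerate on polynomials of degree $<n$. The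
first (`Admissible.eq_zero_of_moment_polyDeriv`) is reduced to the integral of a square by a choice
of $r$; the second (`Admissible.eq_zero_of_epsForm`) is a count of sign changes.

Formulas. From $DK\varepsilon=K+\Phi A\langle\varepsilon\,\cdot,\Phi^t\rangle$ one gets
$DK\varepsilon\Phi^t=C\Phi^t$, which is the meaning of $C$. With nondegeneracy it yields the
invertibility of $C_{11}$ and $\widehat C_{22}$; paired with $\Phi$ under $\varepsilon$ it yields
relations between $B$ and $C$ that imply the skew symmetry. Finally, by nondegeneracy each kernel is
the only one of its shape with a certain reproducing property, and the right-hand sides of (i) are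
checked to have it. -/

namespace LaguerreWidom

noncomputable section

open Filter Topology

/-! ### Functions on the half line with integrable derivative -/

/-- `f` is differentiable on `(0, ∞)` with integrable derivative `f'`. -/
structure HasIntegrableDeriv (f f' : ℝ → ℝ) : Prop where
  hasDerivAt : ∀ x, 0 < x → HasDerivAt f (f' x) x
  integrableOn : IntegrableOn f' (Ioi 0)

/-- The fundamental theorem of calculus from the base point $1$. Boundedness makes products with
integrable functions integrable and removes boundary terms against functions that vanish at both
ends. -/
theorem HasIntegrableDeriv.bounded {f f' : ℝ → ℝ} (h : HasIntegrableDeriv f f') :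
    ∃ M, ∀ x, 0 < x → ‖f x‖ ≤ M := by
  refine ⟨‖f 1‖ + ∫ x in Ioi (0 : ℝ), ‖f' x‖, fun x hx => ?_⟩
  have hsub : uIcc 1 x ⊆ Ioi 0 := fun y hy => lt_of_lt_of_le (lt_min one_pos hx) hy.1
  have hsub' : uIoc 1 x ⊆ Ioi 0 := uIoc_subset_uIcc.trans hsub
  have hftc : ∫ y in (1 : ℝ)..x, f' y = f x - f 1 :=
    intervalIntegral.integral_eq_sub_of_hasDerivAt (fun y hy => h.hasDerivAt y (hsub hy))
      (intervalIntegrable_iff.2 (h.integrableOn.mono_set hsub'))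
  have h1 : ‖f x - f 1‖ ≤ ∫ y in Ioi (0 : ℝ), ‖f' y‖ := by
    rw [← hftc]
    refine intervalIntegral.norm_integral_le_integral_norm_uIoc.trans ?_
    exact setIntegral_mono_set h.integrableOn.norm
      (Eventually.of_forall fun _ => norm_nonneg _) hsub'.eventuallyLE
  calc ‖f x‖ = ‖f 1 + (f x - f 1)‖ := by congr 1; ring
    _ ≤ _ := (norm_add_le _ _).trans (by gcongr)

theorem HasIntegrableDeriv.continuousOn {f f' : ℝ → ℝ} (h : HasIntegrableDeriv f f') :
    ContinuousOn f (Ioi 0) :=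
  fun x hx => (h.hasDerivAt x hx).continuousAt.continuousWithinAt

theorem HasIntegrableDeriv.integrableOn_mul {f f' g : ℝ → ℝ} (h : HasIntegrableDeriv f f')
    (hg : IntegrableOn g (Ioi 0)) : IntegrableOn (fun x => f x * g x) (Ioi 0) := by
  obtain ⟨M, hM⟩ := h.bounded
  exact Integrable.bdd_mul (c := M) hg
    (h.continuousOn.aestronglyMeasurable measurableSet_Ioi)
    ((ae_restrict_iff' measurableSet_Ioi).2 (.of_forall hM))

theorem HasIntegrableDeriv.ip_add_ip {f f' g g' : ℝ → ℝ} (hf : HasIntegrableDeriv f f')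
    (hg : HasIntegrableDeriv g g') {a c : ℝ}
    (h0 : Tendsto (fun x => f x * g x) (𝓝[>] 0) (𝓝 a))
    (h1 : Tendsto (fun x => f x * g x) atTop (𝓝 c)) :
    ip f g' + ip f' g = c - a := by
  have := integral_Ioi_mul_deriv_eq_deriv_mul (a := 0) (u := f) (v := g) (u' := f') (v' := g')
    (a' := a) (b' := c) (fun x hx => hf.hasDerivAt x hx) (fun x hx => hg.hasDerivAt x hx)
    (hf.integrableOn_mul hg.integrableOn)
    ((hg.integrableOn_mul hf.integrableOn).congr_fun (fun _ _ => mul_comm _ _) measurableSet_Ioi)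
    h0 h1
  unfold ip
  linarith

theorem ip_congr {f f' g g' : ℝ → ℝ} (hf : ∀ x, 0 < x → f x = f' x)
    (hg : ∀ x, 0 < x → g x = g' x) : ip f g = ip f' g' :=
  setIntegral_congr_fun measurableSet_Ioi fun x hx => by simp only [hf x hx, hg x hx]

/-! ### The operator `ε` -/

theorem eps_congr {f g : ℝ → ℝ} (h : ∀ x, 0 < x → f x = g x) : eps f = eps g := by
  ext x
  exact setIntegral_congr_fun measurableSet_Ioi fun y hy => by simp only [h y hy]

/-- Extending $g$ by zero makes the primitive a function on all of $\mathbb R$, from which the limit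
at $0$ and the derivative can be read off. -/
theorem eps_eq {g : ℝ → ℝ} (hg : IntegrableOn g (Ioi 0)) {x : ℝ} (hx : 0 < x) :
    eps g x = (∫ y in (0 : ℝ)..x, (Ioi 0).indicator g y) - 1 / 2 * ∫ y in Ioi (0 : ℝ), g y := by
  have h1 : eps g x = ∫ y in Ioi (0 : ℝ), ((Iic x).indicator g y - 1 / 2 * g y) := by
    refine integral_congr_ae ?_
    filter_upwards [ae_restrict_of_ae (Measure.ae_ne volume x)] with y hy
    rcases lt_or_gt_of_ne hy with h | h
    · rw [Real.sign_of_pos (sub_pos.2 h), indicator_of_mem (show y ∈ Iic x from h.le)]; ring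
    · rw [Real.sign_of_neg (sub_neg.2 h), indicator_of_notMem (by simpa using h)]; ring
  rw [h1, integral_sub (hg.indicator measurableSet_Iic) (hg.const_mul _), integral_const_mul,
    setIntegral_indicator measurableSet_Iic, intervalIntegral.integral_of_le hx.le,
    setIntegral_indicator measurableSet_Ioi, Ioi_inter_Iic,
    inter_eq_self_of_subset_left (Ioc_subset_Ioi_self)]

theorem continuous_primitive_indicator {g : ℝ → ℝ} (hg : IntegrableOn g (Ioi 0)) :
    Continuous fun x => ∫ y in (0 : ℝ)..x, (Ioi 0).indicator g y :=
  intervalIntegral.continuous_primitive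
    (fun _ _ => (hg.integrable_indicator measurableSet_Ioi).intervalIntegrable) 0

theorem tendsto_eps_zero {g : ℝ → ℝ} (hg : IntegrableOn g (Ioi 0)) :
    Tendsto (eps g) (𝓝[>] 0) (𝓝 (-(1 / 2 * ∫ y in Ioi (0 : ℝ), g y))) := by
  have h := ((continuous_primitive_indicator hg).tendsto 0).mono_left
    (nhdsWithin_le_nhds (s := Ioi 0))
  rw [intervalIntegral.integral_same] at h
  have h2 := h.sub_const (1 / 2 * ∫ y in Ioi (0 : ℝ), g y)
  rw [zero_sub] at h2
  refine h2.congr' ?_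
  filter_upwards [self_mem_nhdsWithin] with x hx using (eps_eq hg hx).symm

theorem tendsto_eps_atTop {g : ℝ → ℝ} (hg : IntegrableOn g (Ioi 0)) :
    Tendsto (eps g) atTop (𝓝 (1 / 2 * ∫ y in Ioi (0 : ℝ), g y)) := by
  have h := intervalIntegral_tendsto_integral_Ioi (0 : ℝ)
    (hg.integrable_indicator measurableSet_Ioi).integrableOn tendsto_id
  rw [setIntegral_indicator measurableSet_Ioi, inter_self] at h
  have h2 := h.sub_const (1 / 2 * ∫ y in Ioi (0 : ℝ), g y)
  rw [show (∫ y in Ioi (0 : ℝ), g y) - 1 / 2 * ∫ y in Ioi (0 : ℝ), g y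
    = 1 / 2 * ∫ y in Ioi (0 : ℝ), g y by ring] at h2
  refine h2.congr' ?_
  filter_upwards [eventually_gt_atTop 0] with x hx using (eps_eq hg hx).symm

theorem hasDerivAt_eps {g : ℝ → ℝ} (hg : IntegrableOn g (Ioi 0)) (hc : ContinuousOn g (Ioi 0))
    {x : ℝ} (hx : 0 < x) : HasDerivAt (eps g) (g x) x := by
  have hev : (Ioi 0).indicator g =ᶠ[𝓝 x] g := by
    filter_upwards [Ioi_mem_nhds hx] with y hy using indicator_of_mem hy g
  have hcont : ContinuousAt ((Ioi 0).indicator g) x :=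
    (hc.continuousAt (Ioi_mem_nhds hx)).congr hev.symm
  have hint := hg.integrable_indicator measurableSet_Ioi
  have h := (intervalIntegral.integral_hasDerivAt_right (a := 0)
    (hint.intervalIntegrable (a := 0) (b := x))
    hint.aestronglyMeasurable.stronglyMeasurableAtFilter hcont).sub_const
      (1 / 2 * ∫ y in Ioi (0 : ℝ), g y)
  rw [indicator_of_mem (show x ∈ Ioi 0 from hx)] at h
  refine h.congr_of_eventuallyEq ?_
  filter_upwards [Ioi_mem_nhds hx] with y hy using eps_eq hg hy

theorem hasIntegrableDeriv_eps {g : ℝ → ℝ} (hg : IntegrableOn g (Ioi 0))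
    (hc : ContinuousOn g (Ioi 0)) : HasIntegrableDeriv (eps g) g :=
  ⟨fun _ hx => hasDerivAt_eps hg hc hx, hg⟩

/-- The limits of $\varepsilon f$ at $0$ and $\infty$ are $\mp\frac12\int f$, so the product
$\varepsilon f\cdot\varepsilon g$ has the same limit at both ends and integration by parts leaves no
boundary term. -/
theorem ip_eps_antisymm {f g : ℝ → ℝ} (hf : IntegrableOn f (Ioi 0)) (hfc : ContinuousOn f (Ioi 0))
    (hg : IntegrableOn g (Ioi 0)) (hgc : ContinuousOn g (Ioi 0)) :
    ip (eps f) g = -ip f (eps g) := by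
  have h := (hasIntegrableDeriv_eps hf hfc).ip_add_ip (hasIntegrableDeriv_eps hg hgc)
    ((tendsto_eps_zero hf).mul (tendsto_eps_zero hg))
    ((tendsto_eps_atTop hf).mul (tendsto_eps_atTop hg))
  linarith

/-- The difference $\varepsilon f'-f$ is constant on the half line, while its limits at the two ends
are opposite numbers; so it is zero. -/
theorem eps_of_hasIntegrableDeriv {f f' : ℝ → ℝ} (h : HasIntegrableDeriv f f')
    (hc : ContinuousOn f' (Ioi 0)) (h0 : Tendsto f (𝓝[>] 0) (𝓝 0)) (h1 : Tendsto f atTop (𝓝 0))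
    {x : ℝ} (hx : 0 < x) : eps f' x = f x := by
  have hd : ∀ y, 0 < y → HasDerivAt (fun y => eps f' y - f y) 0 y := fun y hy => by
    have := (hasDerivAt_eps h.integrableOn hc hy).sub (h.hasDerivAt y hy)
    rwa [sub_self] at this
  have hconst : ∀ y, 0 < y → eps f' y - f y = eps f' x - f x := fun y hy =>
    isOpen_Ioi.is_const_of_deriv_eq_zero (isPreconnected_Ioi (a := (0 : ℝ)))
      (fun z hz => (hd z hz).differentiableAt.differentiableWithinAt)
      (fun z hz => (hd z hz).deriv) hy hx
  have t0 := ((tendsto_eps_zero h.integrableOn).sub h0).congr' (f₂ := fun _ => eps f' x - f x) (by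
    filter_upwards [self_mem_nhdsWithin] with y hy using hconst y hy)
  have t1 := ((tendsto_eps_atTop h.integrableOn).sub h1).congr' (f₂ := fun _ => eps f' x - f x) (by
    filter_upwards [eventually_gt_atTop 0] with y hy using hconst y hy)
  have e0 := tendsto_nhds_unique t0 tendsto_const_nhds
  have e1 := tendsto_nhds_unique t1 tendsto_const_nhds
  linarith

/-! ### The functions `q √w / x` -/

/-- The hypotheses on the parameters of the weight. -/
structure Admissible (α : ℝ) (V : ℝ[X]) : Prop where
  pos : 0 < α
  natDegree_pos : 0 < V.natDegree
  leadingCoeff_pos : 0 < V.leadingCoeff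

variable {α : ℝ} {V : ℝ[X]}

/-- For a polynomial `q`, the function `q √w / x`. -/
def withWeightDiv (α : ℝ) (V q : ℝ[X]) (x : ℝ) : ℝ := q.eval x * Real.sqrt (weight α V x) / x

theorem weight_pos (α : ℝ) (V : ℝ[X]) {x : ℝ} (hx : 0 < x) : 0 < weight α V x := by
  unfold weight; positivity

theorem withWeight_eq {x : ℝ} (hx : x ≠ 0) (q : ℝ[X]) :
    withWeight α V q x = withWeightDiv α V (X * q) x := by
  rw [withWeight, withWeightDiv, eval_mul, eval_X]
  field_simp

/-- The square root is a weight of the same family, with $\alpha/2$ and $V/2$, so integrability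
results for $w$ also serve for $\sqrt w$. -/
theorem sqrt_weight (α : ℝ) (V : ℝ[X]) {x : ℝ} (hx : 0 < x) :
    Real.sqrt (weight α V x) = weight (α / 2) (C (1 / 2) * V) x := by
  rw [Real.sqrt_eq_iff_mul_self_eq (weight_pos α V hx).le (weight_pos _ _ hx).le]
  simp only [weight, eval_mul, eval_C]
  rw [mul_mul_mul_comm, ← Real.rpow_add hx, ← Real.exp_add]
  congr 2 <;> ring

theorem Admissible.half (h : Admissible α V) : Admissible (α / 2) (C (1 / 2) * V) where
  pos := half_pos h.pos
  natDegree_pos := by rw [natDegree_C_mul (by norm_num)]; exact h.natDegree_pos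
  leadingCoeff_pos := by
    rw [leadingCoeff_mul, leadingCoeff_C]; exact mul_pos (by norm_num) h.leadingCoeff_pos

/-- Near $0$ the integrand is a continuous function times $x^{\alpha-1}$, and $\alpha>0$; beyond $1$
the division by $x$ only decreases it. -/
theorem Admissible.integrableOn_poly_weight_div (h : Admissible α V) (q : ℝ[X]) :
    IntegrableOn (fun x => q.eval x * weight α V x / x) (Ioi 0) := by
  rw [← Ioc_union_Ioi_eq_Ioi (zero_le_one' ℝ)]
  refine IntegrableOn.union ?_ ?_
  · have h1 : IntervalIntegrable (fun x : ℝ => x ^ (α - 1)) volume 0 1 :=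
      intervalIntegral.intervalIntegrable_rpow' (by linarith [h.pos])
    have hc : Continuous fun x : ℝ => q.eval x * Real.exp (-V.eval x) := by
      have := V.continuous
      have := q.continuous
      fun_prop
    have h2 := (intervalIntegrable_iff_integrableOn_Ioc_of_le zero_le_one).1
      (h1.continuousOn_mul hc.continuousOn)
    refine h2.congr_fun (fun x hx => ?_) measurableSet_Ioc
    simp only [weight]
    rw [Real.rpow_sub_one hx.1.ne']
    ring
  · have h1 := (integrable_poly_weight h.pos h.natDegree_pos h.leadingCoeff_pos q).mono_set
      (Ioi_subset_Ioi (zero_le_one' ℝ))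
    refine Integrable.mono h1 ?_ ((ae_restrict_iff' measurableSet_Ioi).2 (.of_forall ?_))
    · refine ContinuousOn.aestronglyMeasurable (ContinuousOn.div
        (continuous_poly_weight h.pos V q).continuousOn continuousOn_id ?_) measurableSet_Ioi
      exact fun x hx => (zero_lt_one.trans hx).ne'
    · intro x hx
      rw [norm_div]
      exact div_le_self (norm_nonneg _) ((le_abs_self x).trans' (le_of_lt hx))

theorem Admissible.integrableOn_withWeightDiv (h : Admissible α V) (q : ℝ[X]) :
    IntegrableOn (withWeightDiv α V q) (Ioi 0) :=
  (h.half.integrableOn_poly_weight_div q).congr_fun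
    (fun x hx => by simp only [withWeightDiv, sqrt_weight α V hx]) measurableSet_Ioi

theorem continuous_withWeight (hα : 0 < α) (q : ℝ[X]) : Continuous (withWeight α V q) :=
  q.continuous.mul (by simpa using (continuous_poly_weight hα V 1).sqrt)

theorem continuousOn_withWeightDiv (hα : 0 < α) (q : ℝ[X]) :
    ContinuousOn (withWeightDiv α V q) (Ioi 0) :=
  (continuous_withWeight hα q).continuousOn.div continuousOn_id fun _ hx => ne_of_gt hx

/-- The derivative of `q √w` is `(δ q) √w / x`. -/
def polyDeriv (α : ℝ) (V : ℝ[X]) : ℝ[X] →ₗ[ℝ] ℝ[X] where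
  toFun q := X * derivative q + C (1 / 2) * ((C α - X * derivative V) * q)
  map_add' q r := by rw [derivative_add]; ring
  map_smul' c q := by
    simp only [smul_eq_C_mul, derivative_mul, derivative_C, RingHom.id_apply]; ring

theorem polyDeriv_apply (q : ℝ[X]) : polyDeriv α V q =
    X * derivative q + C (1 / 2) * ((C α - X * derivative V) * q) := rfl

theorem hasDerivAt_withWeight (q : ℝ[X]) {x : ℝ} (hx : 0 < x) :
    HasDerivAt (withWeight α V q) (withWeightDiv α V (polyDeriv α V q) x) x := by
  have h1 : HasDerivAt (fun y => q.eval y * weight (α / 2) (C (1 / 2) * V) y)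
      (withWeightDiv α V (polyDeriv α V q) x) x := by
    have hd := (q.hasDerivAt x).mul ((Real.hasDerivAt_rpow_const (p := α / 2) (Or.inl hx.ne')).mul
      (((C (1 / 2) * V).hasDerivAt x).neg.exp))
    refine hd.congr_deriv ?_
    rw [withWeightDiv, sqrt_weight α V hx, weight, Real.rpow_sub_one hx.ne', polyDeriv_apply]
    simp only [derivative_mul, derivative_C, eval_add, eval_mul, eval_X, eval_C, eval_sub, eval_zero,
      Pi.mul_apply, Pi.neg_apply]
    field_simp
    ring
  refine h1.congr_of_eventuallyEq ?_
  filter_upwards [Ioi_mem_nhds hx] with y hy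
  rw [withWeight, sqrt_weight α V hy]

theorem Admissible.hasIntegrableDeriv_withWeight (h : Admissible α V) (q : ℝ[X]) :
    HasIntegrableDeriv (withWeight α V q) (withWeightDiv α V (polyDeriv α V q)) :=
  ⟨fun _ hx => hasDerivAt_withWeight q hx, h.integrableOn_withWeightDiv _⟩

theorem Admissible.tendsto_withWeight_zero (h : Admissible α V) (q : ℝ[X]) :
    Tendsto (withWeight α V q) (𝓝[>] 0) (𝓝 0) := by
  have h1 := ((continuous_withWeight (V := V) h.pos q).tendsto 0).mono_left
    (nhdsWithin_le_nhds (s := Ioi 0))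
  have : withWeight α V q 0 = 0 := by simp [withWeight, weight, Real.zero_rpow h.pos.ne']
  rwa [this] at h1

/-- A function that is integrable together with its derivative tends to zero. -/
theorem Admissible.tendsto_withWeight_atTop (h : Admissible α V) (q : ℝ[X]) :
    Tendsto (withWeight α V q) atTop (𝓝 0) :=
  tendsto_zero_of_hasDerivAt_of_integrableOn_Ioi (a := 0)
    (fun _ hx => hasDerivAt_withWeight q hx) (h.integrableOn_withWeightDiv _)
    ((h.integrableOn_withWeightDiv (X * q)).congr_fun
      (fun _ hx => (withWeight_eq (ne_of_gt hx) q).symm) measurableSet_Ioi)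

theorem Admissible.eps_polyDeriv (h : Admissible α V) (q : ℝ[X]) {x : ℝ} (hx : 0 < x) :
    eps (withWeightDiv α V (polyDeriv α V q)) x = withWeight α V q x :=
  eps_of_hasIntegrableDeriv (h.hasIntegrableDeriv_withWeight q)
    (continuousOn_withWeightDiv h.pos _) (h.tendsto_withWeight_zero q)
    (h.tendsto_withWeight_atTop q) hx

theorem Admissible.ip_withWeight_deriv (h : Admissible α V) (q : ℝ[X]) {f f' : ℝ → ℝ}
    (hf : HasIntegrableDeriv f f') :
    ip (withWeight α V q) f' = -ip (withWeightDiv α V (polyDeriv α V q)) f := by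
  obtain ⟨M, hM⟩ := hf.bounded
  have key : ∀ l : Filter ℝ, (∀ᶠ x in l, 0 < x) → Tendsto (withWeight α V q) l (𝓝 0) →
      Tendsto (fun x => withWeight α V q x * f x) l (𝓝 0) := fun l hl ht =>
    ht.zero_mul_isBoundedUnder_le ⟨M, by
      rw [eventually_map]; filter_upwards [hl] with x hx using hM x hx⟩
  have := (h.hasIntegrableDeriv_withWeight q).ip_add_ip hf
    (key _ self_mem_nhdsWithin (h.tendsto_withWeight_zero q))
    (key _ (eventually_gt_atTop 0) (h.tendsto_withWeight_atTop q))
  linarith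

/-! ### Linear functionals on polynomials -/

/-- `q ↦ q(x) √w(x) / x`. -/
def withWeightDivL (α : ℝ) (V : ℝ[X]) (x : ℝ) : ℝ[X] →ₗ[ℝ] ℝ where
  toFun q := withWeightDiv α V q x
  map_add' q r := by simp only [withWeightDiv, eval_add]; ring
  map_smul' c q := by simp only [withWeightDiv, eval_smul, smul_eq_mul, RingHom.id_apply]; ring

/-- `q ↦ ∫₀^∞ q w / x`. -/
def Admissible.moment (h : Admissible α V) : ℝ[X] →ₗ[ℝ] ℝ where
  toFun q := ∫ x in Ioi (0 : ℝ), q.eval x * weight α V x / x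
  map_add' q r := by
    rw [← integral_add (h.integrableOn_poly_weight_div q) (h.integrableOn_poly_weight_div r)]
    congr 1; ext x; rw [eval_add]; ring
  map_smul' c q := by
    rw [RingHom.id_apply, smul_eq_mul, ← integral_const_mul]
    congr 1; ext x; rw [eval_smul, smul_eq_mul]; ring

/-- `q ↦ ε (q √w / x) (y)`. -/
def Admissible.epsL (h : Admissible α V) (y : ℝ) : ℝ[X] →ₗ[ℝ] ℝ where
  toFun q := eps (withWeightDiv α V q) y
  map_add' q r := by
    have hs : AEStronglyMeasurable (fun z => (1 / 2) * Real.sign (y - z))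
        (volume.restrict (Ioi 0)) := by
      have hm : Measurable Real.sign :=
        Measurable.ite measurableSet_Iio measurable_const
          (Measurable.ite measurableSet_Ioi measurable_const measurable_const)
      exact ((hm.comp (measurable_const.sub measurable_id)).const_mul _).aestronglyMeasurable
    have hi : ∀ q, IntegrableOn (fun z => (1 / 2) * Real.sign (y - z) * withWeightDiv α V q z)
        (Ioi 0) := fun q => by
      refine Integrable.bdd_mul (c := 1) (h.integrableOn_withWeightDiv q) hs (.of_forall fun z => ?_)
      rcases Real.sign_apply_eq (y - z) with h | h | h <;> rw [h] <;> norm_num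
    unfold eps
    rw [← integral_add (hi q) (hi r)]
    congr 1; ext z
    simp only [withWeightDiv, eval_add]; ring
  map_smul' c q := by
    rw [RingHom.id_apply, smul_eq_mul, eps, eps, ← integral_const_mul]
    congr 1; ext z
    simp only [withWeightDiv, eval_smul, smul_eq_mul]; ring

theorem Admissible.epsL_apply (h : Admissible α V) (y : ℝ) (q : ℝ[X]) :
    h.epsL y q = eps (withWeightDiv α V q) y := rfl

theorem Admissible.hasIntegrableDeriv_eps (h : Admissible α V) (q : ℝ[X]) :
    HasIntegrableDeriv (eps (withWeightDiv α V q)) (withWeightDiv α V q) :=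
  LaguerreWidom.hasIntegrableDeriv_eps (h.integrableOn_withWeightDiv q)
    (continuousOn_withWeightDiv h.pos q)

theorem Admissible.integrableOn_eps_mul (h : Admissible α V) (q r : ℝ[X]) :
    IntegrableOn (fun x => eps (withWeightDiv α V q) x * withWeightDiv α V r x) (Ioi 0) :=
  (h.hasIntegrableDeriv_eps q).integrableOn_mul (h.integrableOn_withWeightDiv r)

/-- The antisymmetric form `⟨ε (q √w / x), r √w / x⟩`. -/
def Admissible.epsForm (h : Admissible α V) : ℝ[X] →ₗ[ℝ] ℝ[X] →ₗ[ℝ] ℝ :=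
  LinearMap.mk₂ ℝ (fun q r => ip (eps (withWeightDiv α V q)) (withWeightDiv α V r))
    (fun q q' r => by
      simp only [ip]
      rw [← integral_add (h.integrableOn_eps_mul q r) (h.integrableOn_eps_mul q' r)]
      congr 1; ext x
      simp only [← h.epsL_apply, map_add]; ring)
    (fun c q r => by
      simp only [ip]
      rw [smul_eq_mul, ← integral_const_mul]
      congr 1; ext x
      simp only [← h.epsL_apply, map_smul, smul_eq_mul]; ring)
    (fun q r r' => by
      simp only [ip]
      rw [← integral_add (h.integrableOn_eps_mul q r) (h.integrableOn_eps_mul q r')]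
      congr 1; ext x
      simp only [withWeightDiv, eval_add]; ring)
    (fun c q r => by
      simp only [ip]
      rw [smul_eq_mul, ← integral_const_mul]
      congr 1; ext x
      simp only [withWeightDiv, eval_smul, smul_eq_mul]; ring)

theorem Admissible.epsForm_apply (h : Admissible α V) (q r : ℝ[X]) :
    h.epsForm q r = ip (eps (withWeightDiv α V q)) (withWeightDiv α V r) := rfl

theorem ip_comm (f g : ℝ → ℝ) : ip f g = ip g f := by
  simp only [ip, mul_comm]

theorem Admissible.epsForm_antisymm (h : Admissible α V) (q r : ℝ[X]) :
    h.epsForm q r = -h.epsForm r q := by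
  rw [h.epsForm_apply, h.epsForm_apply, ip_eps_antisymm (h.integrableOn_withWeightDiv q)
    (continuousOn_withWeightDiv h.pos q) (h.integrableOn_withWeightDiv r)
    (continuousOn_withWeightDiv h.pos r), ip_comm]

theorem Admissible.ip_withWeight (h : Admissible α V) (q r : ℝ[X]) :
    ip (withWeight α V q) (withWeightDiv α V r) = h.moment (q * r) := by
  refine setIntegral_congr_fun measurableSet_Ioi fun x hx => ?_
  simp only [withWeight, withWeightDiv, eval_mul]
  rw [← Real.mul_self_sqrt (weight_pos α V hx).le]
  simp only [Real.sqrt_mul_self (Real.sqrt_nonneg _)]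
  ring

/-- This is $\varepsilon D=1$ on $q\sqrt w$. It is the bridge between the two bilinear forms, and
every later computation with $\varepsilon$ passes through it. -/
theorem Admissible.epsForm_polyDeriv (h : Admissible α V) (q r : ℝ[X]) :
    h.epsForm (polyDeriv α V q) r = h.moment (q * r) := by
  rw [h.epsForm_apply, ← h.ip_withWeight]
  exact ip_congr (fun x hx => h.eps_polyDeriv q hx) fun _ _ => rfl

theorem Admissible.moment_polyDeriv_antisymm (h : Admissible α V) (q r : ℝ[X]) :
    h.moment (polyDeriv α V q * r) = -h.moment (polyDeriv α V r * q) := by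
  rw [mul_comm, ← h.epsForm_polyDeriv, h.epsForm_antisymm, h.epsForm_polyDeriv, mul_comm]

theorem Admissible.wip_eq (h : Admissible α V) (q r : ℝ[X]) :
    wip α V q r = h.moment (X * (q * r)) := by
  refine setIntegral_congr_fun measurableSet_Ioi fun x hx => ?_
  have : x ≠ 0 := ne_of_gt hx
  simp only [eval_mul, eval_X]
  field_simp

theorem withWeightDiv_injective {q r : ℝ[X]}
    (h : ∀ x, 0 < x → withWeightDiv α V q x = withWeightDiv α V r x) : q = r := by
  refine Polynomial.eq_of_infinite_eval_eq q r ((Ioi_infinite (0 : ℝ)).mono fun x hx => ?_)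
  have hx' : (0 : ℝ) < x := hx
  have h1 := h x hx
  have h2 := Real.sqrt_pos.2 (weight_pos α V hx)
  simp only [withWeightDiv] at h1
  field_simp at h1
  simpa using h1

/-! ### Sequences of polynomials with `deg r_k = k` -/

theorem map_eq_zero_of_degree_seq {r : ℕ → ℝ[X]} (hr : ∀ k, (r k).degree = k) {n : ℕ}
    {M : Type*} [AddCommGroup M] [Module ℝ M] (f : ℝ[X] →ₗ[ℝ] M) (hf : ∀ k < n, f (r k) = 0)
    {q : ℝ[X]} (hq : q ∈ degreeLT ℝ n) : f q = 0 := by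
  let S : Polynomial.Sequence ℝ := ⟨r, hr⟩
  rw [← S.span_degreeLT (m := n) fun i _ => isUnit_iff_ne_zero.2
    (leadingCoeff_ne_zero.2 (S.ne_zero i))] at hq
  have : Submodule.span ℝ (S '' Iio n) ≤ LinearMap.ker f := by
    rw [Submodule.span_le]
    rintro _ ⟨k, hk, rfl⟩
    exact hf k hk
  exact this hq

theorem sum_degree_seq_eq_zero {r : ℕ → ℝ[X]} (hr : ∀ k, (r k).degree = k) {n : ℕ}
    {v : Fin n → ℝ} (hv : ∑ k, v k • r k = 0) : v = 0 := by
  let S : Polynomial.Sequence ℝ := ⟨r, hr⟩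
  have h := S.linearIndependent.comp (fun k : Fin n => (k : ℕ)) Fin.val_injective
  exact funext (Fintype.linearIndependent_iff.1 h v hv)

theorem degree_seq_mem_degreeLT {r : ℕ → ℝ[X]} (hr : ∀ k, (r k).degree = k) {k n : ℕ}
    (hk : k < n) : r k ∈ degreeLT ℝ n := by
  rw [mem_degreeLT, hr k]; exact_mod_cast hk

/-! ### Orthonormality -/

theorem Admissible.natDegree_orthoPoly (h : Admissible α V) (k : ℕ) :
    (orthoPoly α V k).natDegree = k :=
  (orthoPoly_spec h.pos h.natDegree_pos h.leadingCoeff_pos k k).1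

theorem Admissible.leadingCoeff_orthoPoly_pos (h : Admissible α V) (k : ℕ) :
    0 < (orthoPoly α V k).leadingCoeff :=
  (orthoPoly_spec h.pos h.natDegree_pos h.leadingCoeff_pos k k).2.1

theorem Admissible.degree_orthoPoly (h : Admissible α V) (k : ℕ) :
    (orthoPoly α V k).degree = k := by
  rw [degree_eq_natDegree (leadingCoeff_ne_zero.1 (h.leadingCoeff_orthoPoly_pos k).ne'),
    h.natDegree_orthoPoly]

theorem Admissible.moment_orthoPoly (h : Admissible α V) (k l : ℕ) :
    h.moment (X * (orthoPoly α V k * orthoPoly α V l)) = if k = l then 1 else 0 := by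
  rw [← h.wip_eq]
  exact (orthoPoly_spec h.pos h.natDegree_pos h.leadingCoeff_pos k l).2.2

theorem Admissible.moment_sq_pos (h : Admissible α V) {q : ℝ[X]} (hq : q ≠ 0) :
    0 < h.moment (X * (q * q)) := by
  rw [← h.wip_eq]
  exact wip_self_pos h.pos h.natDegree_pos h.leadingCoeff_pos hq

theorem Admissible.orthoPoly_mem (h : Admissible α V) {k n : ℕ} (hk : k < n) :
    orthoPoly α V k ∈ degreeLT ℝ n :=
  degree_seq_mem_degreeLT h.degree_orthoPoly hk

/-- `q ↦ ∑_{k < n} ⟨q √w / x, φ_k⟩ p_k`. -/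
def Admissible.proj (h : Admissible α V) (n : ℕ) : ℝ[X] →ₗ[ℝ] ℝ[X] :=
  ∑ k ∈ Finset.range n,
    (h.moment ∘ₗ LinearMap.mulRight ℝ (orthoPoly α V k)).smulRight (orthoPoly α V k)

theorem Admissible.proj_apply (h : Admissible α V) (n : ℕ) (q : ℝ[X]) :
    h.proj n q = ∑ k ∈ Finset.range n, h.moment (q * orthoPoly α V k) • orthoPoly α V k := by
  simp [Admissible.proj]

/-- The function attached to $Xq$ is $q\sqrt w$ itself, so this is the statement that $K$ acts as
the identity on its range. -/
theorem Admissible.proj_X_mul (h : Admissible α V) {n : ℕ} {q : ℝ[X]} (hq : q ∈ degreeLT ℝ n) :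
    h.proj n (X * q) = q := by
  have key := map_eq_zero_of_degree_seq h.degree_orthoPoly
    (f := h.proj n ∘ₗ LinearMap.mulLeft ℝ X - LinearMap.id) (fun k hk => ?_) hq
  · simpa [sub_eq_zero] using key
  · simp only [LinearMap.sub_apply, LinearMap.comp_apply, LinearMap.mulLeft_apply,
      LinearMap.id_apply, h.proj_apply, mul_assoc, h.moment_orthoPoly, ite_smul, one_smul, zero_smul]
    rw [Finset.sum_ite_eq, if_pos (Finset.mem_range.2 hk), sub_self]

theorem Admissible.expansion (h : Admissible α V) {n : ℕ} {q : ℝ[X]} (hq : q ∈ degreeLT ℝ n) :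
    ∑ k ∈ Finset.range n, h.moment (X * (q * orthoPoly α V k)) • orthoPoly α V k = q := by
  conv_rhs => rw [← h.proj_X_mul hq, h.proj_apply]
  simp only [mul_assoc]

theorem Admissible.moment_orthoPoly_of_mem (h : Admissible α V) {n l : ℕ} {q : ℝ[X]}
    (hq : q ∈ degreeLT ℝ n) (hl : n ≤ l) : h.moment (X * (q * orthoPoly α V l)) = 0 := by
  refine map_eq_zero_of_degree_seq h.degree_orthoPoly
    (f := h.moment ∘ₗ LinearMap.mulLeft ℝ X ∘ₗ LinearMap.mulRight ℝ (orthoPoly α V l))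
    (fun k hk => ?_) hq
  simpa [h.moment_orthoPoly] using fun h => by omega

theorem Admissible.eq_zero_of_moment (h : Admissible α V) {n : ℕ} {q : ℝ[X]}
    (hq : q ∈ degreeLT ℝ n) (h0 : ∀ k < n, h.moment (X * (q * orthoPoly α V k)) = 0) : q = 0 := by
  rw [← h.expansion hq]
  exact Finset.sum_eq_zero fun k hk => by rw [h0 k (Finset.mem_range.1 hk), zero_smul]

/-! ### The Christoffel-Darboux formula -/

/-- The polynomial `K_n(·, y)` (without the weight). -/
def reproPoly (α : ℝ) (V : ℝ[X]) (n : ℕ) (y : ℝ) : ℝ[X] :=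
  ∑ k ∈ Finset.range n, (orthoPoly α V k).eval y • orthoPoly α V k

theorem Admissible.moment_reproPoly (h : Admissible α V) {n : ℕ} (y : ℝ) {q : ℝ[X]}
    (hq : q ∈ degreeLT ℝ n) : h.moment (X * (reproPoly α V n y * q)) = q.eval y := by
  conv_rhs => rw [← h.expansion hq]
  simp only [reproPoly, eval_finsetSum, eval_smul, smul_eq_mul, Finset.sum_mul, Finset.mul_sum,
    map_sum, smul_mul_assoc, mul_smul_comm, map_smul]
  exact Finset.sum_congr rfl fun k _ => by rw [mul_comm q, mul_comm (h.moment _)]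

theorem reproPoly_mem (h : Admissible α V) (n : ℕ) (y : ℝ) :
    reproPoly α V n y ∈ degreeLT ℝ n :=
  Submodule.sum_mem _ fun _ hk => Submodule.smul_mem _ _ (h.orthoPoly_mem (Finset.mem_range.1 hk))

theorem X_sub_C_mul_mem {n : ℕ} {q : ℝ[X]} (hq : q ∈ degreeLT ℝ n) (y : ℝ) :
    (X - C y) * q ∈ degreeLT ℝ (n + 1) := by
  rw [mem_degreeLT] at hq ⊢
  rw [degree_mul, degree_X_sub_C, add_comm (n : ℕ), Nat.cast_add, Nat.cast_one]
  exact WithBot.add_lt_add_left (by simp) hq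

/-- Both terms have degree $n+1$, and the ratio $\gamma_n/\gamma_{n+1}$ is the factor that makes the
leading coefficients agree. -/
theorem Admissible.X_sub_C_mul_orthoPoly (h : Admissible α V) (n : ℕ) (y : ℝ) :
    (X - C y) * orthoPoly α V n - gammaRatio α V (n + 1) • orthoPoly α V (n + 1) ∈
      degreeLT ℝ (n + 1) := by
  have hr : gammaRatio α V (n + 1) ≠ 0 :=
    div_ne_zero (h.leadingCoeff_orthoPoly_pos _).ne' (h.leadingCoeff_orthoPoly_pos _).ne'
  have hd1 : ((X - C y) * orthoPoly α V n).degree = ((n + 1 : ℕ) : WithBot ℕ) := by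
    rw [degree_mul, degree_X_sub_C, h.degree_orthoPoly, add_comm, Nat.cast_add, Nat.cast_one]
  have hd2 : (gammaRatio α V (n + 1) • orthoPoly α V (n + 1)).degree =
      ((n + 1 : ℕ) : WithBot ℕ) := by
    rw [degree_smul_of_smul_regular _ (IsSMulRegular.of_ne_zero hr), h.degree_orthoPoly]
  rw [mem_degreeLT, ← hd1]
  refine degree_sub_lt_left (hd1.trans hd2.symm) (fun h0 => ?_) ?_
  · rw [h0, degree_zero] at hd1
    exact WithBot.bot_ne_coe hd1
  rw [leadingCoeff_mul, leadingCoeff_X_sub_C, one_mul, smul_eq_C_mul, leadingCoeff_mul,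
    leadingCoeff_C, gammaRatio, Nat.add_sub_cancel,
    div_mul_cancel₀ _ (h.leadingCoeff_orthoPoly_pos _).ne']

/-- Both sides have degree at most $n+1$, so it suffices to pair with $p_l$, $l\le n+1$, moving
$X-y$ onto $p_l$. For $l<n$ the reproducing property evaluates $(X-y)p_l$ at $y$, giving zero. For
$l=n$ one splits off the multiple of $p_{n+1}$ and evaluates the remainder at $y$. For $l=n+1$ only
the summand $k=n$ of the kernel reaches degree $n+1$. -/
theorem Admissible.christoffel_darboux (h : Admissible α V) (n : ℕ) (y : ℝ) :
    (X - C y) * reproPoly α V (n + 1) y = gammaRatio α V (n + 1) •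
      ((orthoPoly α V n).eval y • orthoPoly α V (n + 1)
        - (orthoPoly α V (n + 1)).eval y • orthoPoly α V n) := by
  set g := gammaRatio α V (n + 1) with hg
  set t := (X - C y) * orthoPoly α V n - g • orthoPoly α V (n + 1) with ht
  have htm : t ∈ degreeLT ℝ (n + 1) := h.X_sub_C_mul_orthoPoly n y
  have hXn : (X - C y) * orthoPoly α V n = g • orthoPoly α V (n + 1) + t := by rw [ht]; ring
  have hty : t.eval y = -(g * (orthoPoly α V (n + 1)).eval y) := by simp [ht]
  rw [← sub_eq_zero]
  refine h.eq_zero_of_moment (n := n + 2) ?_ fun l hl => ?_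
  · refine Submodule.sub_mem _ (X_sub_C_mul_mem (reproPoly_mem h _ _) y) (Submodule.smul_mem _ _
      (Submodule.sub_mem _ (Submodule.smul_mem _ _ (h.orthoPoly_mem (by omega)))
        (Submodule.smul_mem _ _ (h.orthoPoly_mem (by omega)))))
  have hrhs : h.moment (X * (g • ((orthoPoly α V n).eval y • orthoPoly α V (n + 1)
      - (orthoPoly α V (n + 1)).eval y • orthoPoly α V n) * orthoPoly α V l)) =
      g * ((orthoPoly α V n).eval y * (if n + 1 = l then 1 else 0)
        - (orthoPoly α V (n + 1)).eval y * (if n = l then 1 else 0)) := by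
    simp only [smul_mul_assoc, sub_mul, mul_smul_comm, mul_sub, map_sub, map_smul,
      h.moment_orthoPoly, smul_eq_mul]
  rw [sub_mul, mul_sub, map_sub, hrhs, sub_eq_zero, mul_right_comm, mul_comm (_ * _)]
  rcases lt_trichotomy l n with hln | rfl | hln
  · rw [h.moment_reproPoly _ (degreeLT_mono (show l + 1 + 1 ≤ n + 1 by omega)
      (X_sub_C_mul_mem (h.orthoPoly_mem (Nat.lt_succ_self l)) y)),
      if_neg (by omega), if_neg (by omega)]
    simp
  · rw [hXn, mul_add, mul_add, map_add, h.moment_reproPoly _ htm, hty, if_neg (by omega),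
      if_pos rfl, mul_smul_comm, mul_smul_comm, map_smul,
      h.moment_orthoPoly_of_mem (reproPoly_mem h _ _) le_rfl]
    simp
  · obtain rfl : l = n + 1 := by omega
    have hlow := h.moment_orthoPoly_of_mem
      (X_sub_C_mul_mem (reproPoly_mem h n y) y) (le_refl (n + 1))
    rw [reproPoly] at hlow
    rw [if_pos rfl, if_neg (by omega), mul_comm (reproPoly _ _ _ _), mul_right_comm, reproPoly,
      Finset.sum_range_succ, mul_add, mul_smul_comm, hXn, smul_add, add_mul, add_mul, mul_add,
      mul_add, map_add, map_add, smul_mul_assoc, smul_mul_assoc, smul_mul_assoc, mul_smul_comm,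
      mul_smul_comm, mul_smul_comm, map_smul, map_smul, map_smul, h.moment_orthoPoly,
      h.moment_orthoPoly_of_mem htm le_rfl, hlow, if_pos rfl]
    simp only [smul_eq_mul]
    ring

theorem Admissible.cauchyZero_eq (h : Admissible α V) (k : ℕ) :
    cauchyZero α V k = h.moment (orthoPoly α V k) := rfl

/-- The polynomial `x ∑_{k < n} c_k p_k - 1`. -/
def cauchyPoly (α : ℝ) (V : ℝ[X]) (n : ℕ) : ℝ[X] :=
  X * ∑ k ∈ Finset.range n, cauchyZero α V k • orthoPoly α V k - 1

/-- Apply $L$ to both sides of Christoffel-Darboux with parameter $x$. The reproducing property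
turns $L(X\cdot K_n(\cdot,x))$ into $1$, the value of the constant polynomial; the other terms
produce the constants $c_k=L(p_k)$. -/
theorem Admissible.cauchyPoly_eq (h : Admissible α V) (n : ℕ) :
    gammaRatio α V (n + 1) • (cauchyZero α V n • orthoPoly α V (n + 1)
      - cauchyZero α V (n + 1) • orthoPoly α V n) = cauchyPoly α V (n + 1) := by
  refine Polynomial.funext fun x => ?_
  have h1 := congrArg h.moment (h.christoffel_darboux n x)
  have h2 := h.moment_reproPoly (n := n + 1) x (q := 1)
    (by rw [mem_degreeLT, degree_one]; exact_mod_cast Nat.succ_pos n)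
  rw [mul_one, eval_one] at h2
  rw [sub_mul, map_sub, h2, C_mul', map_smul, reproPoly] at h1
  simp only [map_sum, map_smul, map_sub, smul_eq_mul, ← h.cauchyZero_eq] at h1
  simp only [cauchyPoly, eval_smul, eval_sub, eval_mul, eval_X, eval_finsetSum, eval_one, smul_eq_mul]
  rw [Finset.sum_congr rfl fun k _ => mul_comm (cauchyZero α V k) _]
  linarith

/-- On degree $<n$ the functional $L$ is represented by $\sum_{k<n}c_kp_k$ in the inner product of
$w$, and the term $-1$ subtracts $L$ itself. This puts $\Psi_2$ in the kernel of $K$. -/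
theorem Admissible.moment_cauchyPoly (h : Admissible α V) {n : ℕ} {q : ℝ[X]}
    (hq : q ∈ degreeLT ℝ n) : h.moment (cauchyPoly α V n * q) = 0 := by
  rw [cauchyPoly, sub_mul, one_mul, map_sub, sub_eq_zero]
  conv_rhs => rw [← h.expansion hq]
  simp only [Finset.sum_mul, Finset.mul_sum, map_sum, smul_mul_assoc, mul_smul_comm, map_smul,
    smul_eq_mul, ← h.cauchyZero_eq]
  exact Finset.sum_congr rfl fun k _ => by rw [mul_assoc, mul_comm q, mul_comm]

theorem Admissible.psiTilde1_eq (h : Admissible α V) (n : ℕ) (x : ℝ) :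
    psiTilde1 α V (n + 1) x = withWeightDiv α V (X * reproPoly α V (n + 1) 0) x := by
  have h1 := h.christoffel_darboux n 0
  rw [C_0, sub_zero] at h1
  rw [h1, withWeightDiv]
  simp only [psiTilde1, phi, withWeight, eval_smul, eval_sub, smul_eq_mul, Nat.add_sub_cancel]
  ring

theorem Admissible.psiTilde2_eq (h : Admissible α V) (n : ℕ) (x : ℝ) :
    psiTilde2 α V (n + 1) x = withWeightDiv α V (cauchyPoly α V (n + 1)) x := by
  rw [← h.cauchyPoly_eq, withWeightDiv]
  simp only [psiTilde2, phi, withWeight, eval_smul, eval_sub, smul_eq_mul, Nat.add_sub_cancel]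
  ring

/-! ### The vector `Φ` -/

/-- The polynomials `q` with `Φ_1 = q √w`. -/
def Phi1Poly (α : ℝ) (V : ℝ[X]) (b d : ℝ) (n : ℕ) (i : Fin V.natDegree) : ℝ[X] :=
  if (i : ℕ) + 1 < V.natDegree then orthoPoly α V (n - 1 - i)
  else (α * d * Real.sqrt (b / n)) • reproPoly α V n 0

/-- The polynomials `q` with `Φ_2 = q √w / x`. -/
def Phi2Poly (α : ℝ) (V : ℝ[X]) (b d : ℝ) (n : ℕ) (i : Fin V.natDegree) : ℝ[X] :=
  if (i : ℕ) + 1 < V.natDegree then X * orthoPoly α V (n + i)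
  else (1 / d * Real.sqrt (b / n)) • cauchyPoly α V n

/-- The polynomials `q` with `Φ = q √w / x`. -/
def PhiPoly (α : ℝ) (V : ℝ[X]) (b d : ℝ) (n : ℕ) : Fin V.natDegree ⊕ Fin V.natDegree → ℝ[X] :=
  Sum.elim (fun i => X * Phi1Poly α V b d n i) (Phi2Poly α V b d n)

section

variable {b d : ℝ} {n : ℕ}

theorem Admissible.Phi1_eq (h : Admissible α V) (hn : n ≠ 0) (i : Fin V.natDegree) {x : ℝ}
    (hx : x ≠ 0) : Phi1 α V b d n i x = withWeightDiv α V (X * Phi1Poly α V b d n i) x := by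
  obtain ⟨n, rfl⟩ := Nat.exists_eq_succ_of_ne_zero hn
  unfold Phi1 Phi1Poly
  split_ifs with hi
  · exact withWeight_eq hx _
  · rw [psi1, Nat.succ_eq_add_one, h.psiTilde1_eq]
    simp only [withWeightDiv, mul_smul_comm, eval_smul, smul_eq_mul]
    ring

theorem Admissible.Phi2_eq (h : Admissible α V) (hn : n ≠ 0) (i : Fin V.natDegree) {x : ℝ}
    (hx : x ≠ 0) : Phi2 α V b d n i x = withWeightDiv α V (Phi2Poly α V b d n i) x := by
  obtain ⟨n, rfl⟩ := Nat.exists_eq_succ_of_ne_zero hn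
  unfold Phi2 Phi2Poly
  split_ifs with hi
  · exact withWeight_eq hx _
  · rw [psi2, Nat.succ_eq_add_one, h.psiTilde2_eq]
    simp only [withWeightDiv, eval_smul, smul_eq_mul]
    ring

theorem Admissible.Phi_eq (h : Admissible α V) (hn : n ≠ 0)
    (i : Fin V.natDegree ⊕ Fin V.natDegree) {x : ℝ} (hx : x ≠ 0) :
    Phi α V b d n i x = withWeightDiv α V (PhiPoly α V b d n i) x := by
  cases i with
  | inl i => exact h.Phi1_eq hn i hx
  | inr i => exact h.Phi2_eq hn i hx

theorem Admissible.Phi1Poly_mem (h : Admissible α V) (hn : n ≠ 0) (i : Fin V.natDegree) :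
    Phi1Poly α V b d n i ∈ degreeLT ℝ n := by
  unfold Phi1Poly
  split_ifs
  · exact h.orthoPoly_mem (by omega)
  · exact Submodule.smul_mem _ _ (reproPoly_mem h n 0)

/-- In operator terms $K\Phi_2=0$: the entries $\phi_{n+i}$ by orthogonality, the last entry by
`Admissible.moment_cauchyPoly`. -/
theorem Admissible.moment_Phi2Poly_mul (h : Admissible α V) (i : Fin V.natDegree) {q : ℝ[X]}
    (hq : q ∈ degreeLT ℝ n) : h.moment (Phi2Poly α V b d n i * q) = 0 := by
  unfold Phi2Poly
  split_ifs
  · rw [mul_assoc, mul_comm (orthoPoly _ _ _)]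
    exact h.moment_orthoPoly_of_mem hq (by omega)
  · rw [smul_mul_assoc, map_smul, h.moment_cauchyPoly hq, smul_zero]

theorem sum_fin_ite {M : Type*} [AddCommMonoid M] {m : ℕ} (hm : 0 < m) (f : ℕ → M) (g : M) :
    ∑ i : Fin m, (if (i : ℕ) + 1 < m then f i else g) = (∑ i ∈ Finset.range (m - 1), f i) + g := by
  obtain ⟨m, rfl⟩ := Nat.exists_eq_succ_of_ne_zero hm.ne'
  rw [Fin.sum_univ_eq_sum_range (fun i => if i + 1 < m.succ then f i else g), Finset.sum_range_succ,
    if_neg (by omega), Nat.succ_sub_one]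
  congr 1
  exact Finset.sum_congr rfl fun i hi => if_pos (by have := Finset.mem_range.1 hi; omega)

theorem Admissible.eval_orthoPoly_zero (h : Admissible α V) (y : ℝ) :
    (orthoPoly α V 0).eval y ≠ 0 := by
  have h0 := h.natDegree_orthoPoly 0
  have h1 := h.leadingCoeff_orthoPoly_pos 0
  rw [eq_C_of_natDegree_eq_zero h0] at h1 ⊢
  rw [eval_C]
  rw [leadingCoeff_C] at h1
  exact h1.ne'

theorem sqrt_div_ne_zero (hb : 0 < b) (hn : n ≠ 0) : Real.sqrt (b / n) ≠ 0 :=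
  (Real.sqrt_pos.2 (div_pos hb (Nat.cast_pos.2 (Nat.pos_of_ne_zero hn)))).ne'

theorem Admissible.moment_reproPoly_orthoPoly (h : Admissible α V) {k : ℕ} (hk : k < n) (y : ℝ) :
    h.moment (X * (reproPoly α V n y * orthoPoly α V k)) = (orthoPoly α V k).eval y :=
  h.moment_reproPoly y (h.orthoPoly_mem hk)

/-- Since $m\le n$, the indices $n-1,\dots,n-m+1$ are all positive, so pairing with $p_0$ sees only
the last entry, through $p_0(0)\ne0$. Pairing with $p_{n-1-i}$ then isolates the other coefficients.
-/
theorem Admissible.sum_Phi1Poly_eq_zero (h : Admissible α V) (hb : 0 < b) (hd : d ≠ 0) (hn : n ≠ 0)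
    (hmn : V.natDegree ≤ n) {v : Fin V.natDegree → ℝ}
    (hv : ∑ i, v i • Phi1Poly α V b d n i = 0) : v = 0 := by
  have hpair : ∀ k, ∑ i, v i * h.moment (X * (Phi1Poly α V b d n i * orthoPoly α V k)) = 0 := by
    intro k
    have := congrArg (fun q => h.moment (X * (q * orthoPoly α V k))) hv
    simpa only [Finset.sum_mul, Finset.mul_sum, map_sum, smul_mul_assoc, mul_smul_comm, map_smul,
      smul_eq_mul, zero_mul, mul_zero, map_zero] using this
  have hlast : ∀ i : Fin V.natDegree, ¬ (i : ℕ) + 1 < V.natDegree → v i = 0 := by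
    intro i hi
    have h0 := hpair 0
    rw [Finset.sum_eq_single i ?_ (by simp), Phi1Poly, if_neg hi, smul_mul_assoc, mul_smul_comm,
      map_smul, h.moment_reproPoly_orthoPoly (Nat.pos_of_ne_zero hn), smul_eq_mul] at h0
    · have := h.eval_orthoPoly_zero 0
      have := sqrt_div_ne_zero hb hn
      have := h.pos.ne'
      simp_all
    · intro j _ hj
      have hj' : (j : ℕ) + 1 < V.natDegree := by
        have := j.2
        have := i.2
        have : (j : ℕ) ≠ i := fun h => hj (Fin.ext h)
        omega
      rw [Phi1Poly, if_pos hj', h.moment_orthoPoly, if_neg (by omega), mul_zero]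
  ext i
  by_cases hi : (i : ℕ) + 1 < V.natDegree
  · have h0 := hpair (n - 1 - i)
    rw [Finset.sum_eq_single i ?_ (by simp), Phi1Poly, if_pos hi, h.moment_orthoPoly, if_pos rfl,
      mul_one] at h0
    · exact h0
    · intro j _ hj
      by_cases hj' : (j : ℕ) + 1 < V.natDegree
      · have : (j : ℕ) ≠ i := fun h => hj (Fin.ext h)
        rw [Phi1Poly, if_pos hj', h.moment_orthoPoly, if_neg (by omega), mul_zero]
      · rw [hlast j hj', zero_mul]
  · exact hlast i hi

/-- At $0$ every entry but the last vanishes, and `cauchyPoly` takes the value $-1$ there. Pairing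
with $p_{n+i}$ then isolates the other coefficients. -/
theorem Admissible.sum_Phi2Poly_eq_zero (h : Admissible α V) (hb : 0 < b) (hd : d ≠ 0) (hn : n ≠ 0)
    {v : Fin V.natDegree → ℝ} (hv : ∑ i, v i • Phi2Poly α V b d n i = 0) : v = 0 := by
  have hlast : ∀ i : Fin V.natDegree, ¬ (i : ℕ) + 1 < V.natDegree → v i = 0 := by
    intro i hi
    have h0 := congrArg (eval 0) hv
    rw [eval_finsetSum, Finset.sum_eq_single i ?_ (by simp), Phi2Poly, if_neg hi] at h0
    · have := sqrt_div_ne_zero hb hn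
      simp_all [cauchyPoly]
    · intro j _ hj
      have hj' : (j : ℕ) + 1 < V.natDegree := by
        have := j.2
        have := i.2
        have : (j : ℕ) ≠ i := fun h => hj (Fin.ext h)
        omega
      rw [Phi2Poly, if_pos hj']
      simp
  ext i
  by_cases hi : (i : ℕ) + 1 < V.natDegree
  · have h0 := congrArg (fun q => h.moment (q * orthoPoly α V (n + i))) hv
    simp only [Finset.sum_mul, map_sum, smul_mul_assoc, map_smul, smul_eq_mul, zero_mul,
      map_zero] at h0
    rw [Finset.sum_eq_single i ?_ (by simp), Phi2Poly, if_pos hi, mul_assoc, h.moment_orthoPoly,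
      if_pos rfl, mul_one] at h0
    · exact h0
    · intro j _ hj
      by_cases hj' : (j : ℕ) + 1 < V.natDegree
      · have : (j : ℕ) ≠ i := fun h => hj (Fin.ext h)
        rw [Phi2Poly, if_pos hj', mul_assoc, h.moment_orthoPoly, if_neg (by omega), mul_zero]
      · rw [hlast j hj', zero_mul]
  · exact hlast i hi

/-- Pairing with $p_k$, $k<n$, annihilates $\Phi_2$ and determines the part in $\Phi_1$, so the two
halves separate. -/
theorem Admissible.sum_PhiPoly_eq_zero (h : Admissible α V) (hb : 0 < b) (hd : d ≠ 0) (hn : n ≠ 0)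
    (hmn : V.natDegree ≤ n) {v : Fin V.natDegree ⊕ Fin V.natDegree → ℝ}
    (hv : ∑ i, v i • PhiPoly α V b d n i = 0) : v = 0 := by
  simp only [Fintype.sum_sum_type, PhiPoly, Sum.elim_inl, Sum.elim_inr, ← mul_smul_comm,
    ← Finset.mul_sum] at hv
  have h1 : ∑ i, v (Sum.inl i) • Phi1Poly α V b d n i = 0 := by
    refine h.eq_zero_of_moment (n := n) (Submodule.sum_mem _ fun i _ =>
      Submodule.smul_mem _ _ (h.Phi1Poly_mem hn i)) fun k hk => ?_
    have h0 := congrArg (fun q => h.moment (q * orthoPoly α V k)) hv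
    have h2 : h.moment ((∑ i, v (Sum.inr i) • Phi2Poly α V b d n i) * orthoPoly α V k) = 0 := by
      simp only [Finset.sum_mul, map_sum, smul_mul_assoc, map_smul,
        h.moment_Phi2Poly_mul _ (h.orthoPoly_mem hk), smul_zero, Finset.sum_const_zero]
    simpa only [add_mul, map_add, h2, add_zero, zero_mul, map_zero, mul_assoc] using h0
  rw [h1, mul_zero, zero_add] at hv
  have e1 := h.sum_Phi1Poly_eq_zero hb hd hn hmn h1
  have e2 := h.sum_Phi2Poly_eq_zero hb hd hn hv
  ext i
  cases i with
  | inl i => exact congrFun e1 i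
  | inr i => exact congrFun e2 i

/-! ### The derivatives of the `φ_k` -/

theorem natDegree_polyDeriv_le (h : Admissible α V) (q : ℝ[X]) :
    (polyDeriv α V q).natDegree ≤ q.natDegree + V.natDegree := by
  have hV := h.natDegree_pos
  have h1 : (X * derivative q).natDegree ≤ q.natDegree + V.natDegree := by
    refine natDegree_mul_le.trans ?_
    rw [natDegree_X]
    have := natDegree_derivative_le q
    omega
  have h2 : (C α - X * derivative V).natDegree ≤ V.natDegree := by
    refine (natDegree_sub_le _ _).trans (max_le (by simp) (natDegree_mul_le.trans ?_))
    rw [natDegree_X]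
    have := natDegree_derivative_le V
    omega
  rw [polyDeriv_apply]
  refine (natDegree_add_le _ _).trans (max_le h1 ?_)
  refine (natDegree_C_mul_le _ _).trans (natDegree_mul_le.trans ?_)
  omega

/-- Divide by $X$: $\delta p_k=Xs_k+c_k$ with $c_k=\frac\alpha2p_k(0)$. In the expansion of $s_k$
the terms of index $<n$ go into $e_k$ and those of index $n+i$ into the entries $\phi_{n+i}$ of
$\Phi_2$. The constant is rewritten by $1=X\sum_{l<n}c_l'p_l-(\text{the polynomial of
}\tilde\psi_2)$, with $c_l'=L(p_l)$. The column of coefficients of each $\phi_{n+i}$ is supported on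
the last few $k$, and that of $\Psi_2$ is proportional to $p_k(0)$, which sums to $K_n(\cdot,0)$; so
both lie in the span of $\Phi_1$. -/
theorem Admissible.exists_polyDeriv_decomposition (h : Admissible α V) (hb : 0 < b) (hd : d ≠ 0)
    (hn : n ≠ 0) :
    ∃ (e : ℕ → ℝ[X]) (ρ : ℕ → Fin V.natDegree → ℝ)
      (A : Matrix (Fin V.natDegree) (Fin V.natDegree) ℝ),
      (∀ k, e k ∈ degreeLT ℝ n) ∧
      (∀ k < n, polyDeriv α V (orthoPoly α V k) = X * e k + ∑ i, ρ k i • Phi2Poly α V b d n i) ∧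
      ∀ i, ∑ k ∈ Finset.range n, ρ k i • orthoPoly α V k = ∑ j, A i j • Phi1Poly α V b d n j := by
  have hm := h.natDegree_pos
  have hsb := sqrt_div_ne_zero hb hn
  set m := V.natDegree with hmdef
  set s : ℕ → ℝ[X] := fun k => (polyDeriv α V (orthoPoly α V k)).divX with hs
  set c : ℕ → ℝ := fun k => (polyDeriv α V (orthoPoly α V k)).coeff 0 with hc
  have hck : ∀ k, c k = α / 2 * (orthoPoly α V k).eval 0 := fun k => by
    simp only [hc, polyDeriv_apply, coeff_zero_eq_eval_zero]
    simp only [eval_add, eval_mul, eval_X, eval_C, eval_sub]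
    ring
  have hsc : ∀ k, polyDeriv α V (orthoPoly α V k) = X * s k + C (c k) := fun k =>
    (X_mul_divX_add _).symm
  have hsdeg : ∀ k, s k ∈ degreeLT ℝ (k + m) := fun k => by
    rw [mem_degreeLT]
    have h1 := natDegree_polyDeriv_le h (orthoPoly α V k)
    rw [h.natDegree_orthoPoly] at h1
    refine lt_of_le_of_lt degree_le_natDegree ?_
    rw [hs]
    simp only [natDegree_divX_eq_natDegree_tsub_one]
    exact_mod_cast (show _ < k + m by omega)
  set σ : ℕ → ℕ → ℝ := fun k l => h.moment (X * (s k * orthoPoly α V l)) with hσ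
  have hσ0 : ∀ k l, k + m ≤ l → σ k l = 0 := fun k l hkl => h.moment_orthoPoly_of_mem (hsdeg k) hkl
  set c2 : ℝ := 1 / d * Real.sqrt (b / n) with hc2
  have hc2' : c2 ≠ 0 := mul_ne_zero (one_div_ne_zero hd) hsb
  set ρ : ℕ → Fin m → ℝ := fun k i => if (i : ℕ) + 1 < m then σ k (n + i) else -(c k) / c2 with hρ
  have hcol : ∀ i, ∑ k ∈ Finset.range n, ρ k i • orthoPoly α V k ∈
      Submodule.span ℝ (Set.range (Phi1Poly α V b d n)) := by
    intro i
    by_cases hi : (i : ℕ) + 1 < m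
    · refine Submodule.sum_mem _ fun k hk => ?_
      have hkn := Finset.mem_range.1 hk
      simp only [hρ, if_pos hi]
      -- The degree bound on $s_k$ kills the coefficient unless $k>n+i-m$. In that case $p_k$ is the
      -- entry of $\Phi_1$ with index $n-1-k<m-1$.
      rcases le_or_gt (k + m) (n + i) with hle | hlt
      · rw [hσ0 _ _ hle, zero_smul]; exact Submodule.zero_mem _
      · refine Submodule.smul_mem _ _ (Submodule.subset_span ⟨⟨n - 1 - k, by omega⟩, ?_⟩)
        rw [Phi1Poly, if_pos (by simp only; omega)]
        congr 1
        simp only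
        omega
    -- The scalar is $-n/(2b)$: the factors $\alpha$ and $d$ in the normalizations of $\Psi_1$ and
    -- $\Psi_2$ cancel.
    · have heq : ∑ k ∈ Finset.range n, ρ k i • orthoPoly α V k =
          (-(α / 2) / c2 / (α * d * Real.sqrt (b / n))) • Phi1Poly α V b d n i := by
        rw [Phi1Poly, if_neg hi, smul_smul, div_mul_cancel₀ _
          (mul_ne_zero (mul_ne_zero h.pos.ne' hd) hsb), reproPoly, Finset.smul_sum]
        refine Finset.sum_congr rfl fun k _ => ?_
        simp only [hρ, if_neg hi, hck, smul_smul]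
        congr 1
        ring
      rw [heq]
      exact Submodule.smul_mem _ _ (Submodule.subset_span ⟨i, rfl⟩)
  choose A hA using fun i => (Submodule.mem_span_range_iff_exists_fun ℝ).1 (hcol i)
  refine ⟨fun k => ∑ l ∈ Finset.range n, σ k l • orthoPoly α V l +
    (c k) • ∑ l ∈ Finset.range n, cauchyZero α V l • orthoPoly α V l, ρ, A, fun k => ?_,
    fun k hk => ?_, fun i => (hA i).symm⟩
  · refine Submodule.add_mem _ (Submodule.sum_mem _ fun l hl => ?_)
      (Submodule.smul_mem _ _ (Submodule.sum_mem _ fun l hl => ?_)) <;>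
    exact Submodule.smul_mem _ _ (h.orthoPoly_mem (Finset.mem_range.1 hl))
  · have h1 : ∑ i, ρ k i • Phi2Poly α V b d n i =
        ∑ i ∈ Finset.range (m - 1), σ k (n + i) • (X * orthoPoly α V (n + i))
          + (-(c k)) • cauchyPoly α V n := by
      rw [← sum_fin_ite hm]
      refine Finset.sum_congr rfl fun i _ => ?_
      simp only [hρ, Phi2Poly]
      by_cases hi : (i : ℕ) + 1 < m
      · rw [if_pos hi, if_pos hi, if_pos hi]
      · rw [if_neg hi, if_neg hi, if_neg hi, smul_smul, div_mul_cancel₀ _ hc2']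
    -- As $k<n$, the degree of $s_k$ is below $n+m-1$, so exactly the $m-1$ polynomials
    -- $p_n,\dots,p_{n+m-2}$ are needed beyond $p_{n-1}$.
    have h2 : s k = ∑ l ∈ Finset.range n, σ k l • orthoPoly α V l +
        ∑ i ∈ Finset.range (m - 1), σ k (n + i) • orthoPoly α V (n + i) := by
      rw [← Finset.sum_range_add (fun l => σ k l • orthoPoly α V l)]
      exact (h.expansion (degreeLT_mono (by omega) (hsdeg k))).symm
    rw [hsc, h1, cauchyPoly]
    conv_lhs => rw [h2]
    simp only [smul_eq_C_mul, C_neg]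
    rw [mul_add, Finset.mul_sum, Finset.mul_sum]
    rw [mul_add, Finset.mul_sum]
    simp only [mul_left_comm X (C _)]
    ring

end

/-! ### Nondegeneracy of `⟨ψ_j, ψ_k'⟩` -/

theorem exists_root_of_odd_natDegree {q : ℝ[X]} (hq : Odd q.natDegree) : ∃ a, q.IsRoot a := by
  wlog hlc : 0 < q.leadingCoeff generalizing q
  · have h0 : q.leadingCoeff ≠ 0 := fun h => by
      rw [leadingCoeff_eq_zero] at h
      simp [h] at hq
    obtain ⟨a, ha⟩ := this (q := -q) (by rwa [natDegree_neg])
      (by rw [leadingCoeff_neg]; exact neg_pos.2 (lt_of_le_of_ne (not_lt.1 hlc) h0))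
    exact ⟨a, by simpa using ha⟩
  have hdeg : 0 < q.degree := natDegree_pos_iff_degree_pos.1 hq.pos
  have htop := q.tendsto_atTop_of_leadingCoeff_nonneg hdeg hlc.le
  have hcomp : (q.comp (-X)).natDegree = q.natDegree := by
    rw [natDegree_comp, natDegree_neg, natDegree_X, mul_one]
  have hbot := (q.comp (-X)).tendsto_atBot_of_leadingCoeff_nonpos
    (natDegree_pos_iff_degree_pos.1 (hcomp.symm ▸ hq.pos)) (by
      rw [leadingCoeff_comp (by simp), leadingCoeff_neg, leadingCoeff_X, hq.neg_one_pow]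
      linarith)
  obtain ⟨x, hx⟩ := (htop.eventually_ge_atTop 0).exists
  obtain ⟨y, hy⟩ := (hbot.eventually_le_atBot 0).exists
  rw [eval_comp, eval_neg, eval_X] at hy
  obtain ⟨a, ha⟩ := mem_range_of_exists_le_of_exists_ge q.continuous ⟨_, hy⟩ ⟨_, hx⟩
  exact ⟨a, ha⟩

theorem polyDeriv_mul_sub (q r : ℝ[X]) : polyDeriv α V q * r - polyDeriv α V r * q =
    X * (derivative q * r - q * derivative r) := by
  rw [polyDeriv_apply, polyDeriv_apply]; ring

/-- By antisymmetry the hypothesis says $L(X(q'r-qr'))=0$, in which the potential has disappeared.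
If $\deg q<n-1$, take $r=Xq$, which gives $q'r-qr'=-q^2$. If $\deg q=n-1$, this degree is odd, so
$q$ has a real root $a$; with $q=(X-a)r$ one gets $q'r-qr'=r^2$. Either way the integral of a
nonzero square against $w$ would vanish. -/
theorem Admissible.eq_zero_of_moment_polyDeriv (h : Admissible α V) {n : ℕ} (hn : Even n)
    {q : ℝ[X]} (hq : q ∈ degreeLT ℝ n)
    (h0 : ∀ r ∈ degreeLT ℝ n, h.moment (polyDeriv α V q * r) = 0) : q = 0 := by
  by_contra hne
  have hwr : ∀ r ∈ degreeLT ℝ n, h.moment (X * (derivative q * r - q * derivative r)) = 0 := by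
    intro r hr
    rw [← polyDeriv_mul_sub (α := α) (V := V), map_sub, h.moment_polyDeriv_antisymm r q, h0 r hr]
    simp
  rw [mem_degreeLT, degree_eq_natDegree hne, Nat.cast_lt] at hq
  rcases lt_or_ge (q.natDegree + 1) n with hlt | hge
  · have h1 := hwr (X * q) (by
      rw [mem_degreeLT, degree_mul, degree_X, degree_eq_natDegree hne, add_comm]
      exact_mod_cast hlt)
    rw [derivative_mul, derivative_X,
      show derivative q * (X * q) - q * (1 * q + X * derivative q) = -(q * q) by ring,
      mul_neg, map_neg] at h1
    linarith [h.moment_sq_pos hne]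
  · have hodd : Odd q.natDegree := by
      have : q.natDegree + 1 = n := by omega
      rw [← this] at hn
      exact Nat.not_even_iff_odd.1 fun h => Nat.not_even_iff_odd.2 h.add_one hn
    obtain ⟨a, ha⟩ := exists_root_of_odd_natDegree hodd
    obtain ⟨r, hr⟩ := dvd_iff_isRoot.2 ha
    have hr0 : r ≠ 0 := fun h => hne (by rw [hr, h, mul_zero])
    have h1 := hwr r (by
      rw [mem_degreeLT, degree_eq_natDegree hr0, Nat.cast_lt]
      exact lt_of_le_of_lt (natDegree_le_of_dvd (hr ▸ dvd_mul_left _ _) hne) hq)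
    rw [hr, derivative_mul, derivative_sub, derivative_X, derivative_C,
      show ((1 - 0) * r + (X - C a) * derivative r) * r - (X - C a) * r * derivative r = r * r by
        ring] at h1
    linarith [h.moment_sq_pos hr0]

/-! ### Sign changes -/

/-- There are `a < x_1 < ⋯ < x_k` such that `σ u(x_1), -σ u(x_2), σ u(x_3), …` are positive. -/
def Alternates (u : ℝ → ℝ) : ℕ → ℝ → ℝ → Prop
  | 0, _, _ => True
  | k + 1, σ, a => ∃ x, a < x ∧ 0 < σ * u x ∧ Alternates u k (-σ) x

theorem Alternates.mono {u : ℝ → ℝ} {k : ℕ} {σ a a' : ℝ} (h : Alternates u k σ a) (ha : a' ≤ a) :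
    Alternates u k σ a' := by
  cases k with
  | zero => trivial
  | succ k =>
    obtain ⟨x, hx, h1, h2⟩ := h
    exact ⟨x, ha.trans_lt hx, h1, h2⟩

theorem Alternates.of_sign {u v : ℝ → ℝ} {k : ℕ} {σ a : ℝ} (h : Alternates u k σ a)
    (huv : ∀ x, a < x → ∀ σ, 0 < σ * u x → 0 < σ * v x) : Alternates v k σ a := by
  induction k generalizing σ a with
  | zero => trivial
  | succ k ih =>
    obtain ⟨x, hx, h1, h2⟩ := h
    exact ⟨x, hx, huv x hx σ h1, ih h2 fun y hy => huv y (hx.trans hy)⟩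

theorem Alternates.extend {u : ℝ → ℝ} {k : ℕ} {σ a : ℝ} (h : Alternates u k σ a)
    (hu : ∀ᶠ x in atTop, 0 < (-1) ^ k * σ * u x) : Alternates u (k + 1) σ a := by
  induction k generalizing σ a with
  | zero =>
    obtain ⟨x, h1, h2⟩ := (hu.and (eventually_gt_atTop a)).exists
    exact ⟨x, h2, by simpa using h1, trivial⟩
  | succ k ih =>
    obtain ⟨x, hx, h1, h2⟩ := h
    exact ⟨x, hx, h1, ih h2 (hu.mono fun y hy => by rw [pow_succ] at hy; linarith)⟩

/-- Greedy choice of roots: $P$ is given a root at the infimum of the points where $\sigma u>0$, and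
the recursion continues to the right of it with $-\sigma$. The condition on $x\le a$ is carried
along so that the new linear factor alone decides the sign to the left of its root. -/
theorem exists_poly_of_not_alternates {u : ℝ → ℝ} {k : ℕ} {σ a : ℝ}
    (h : ¬ Alternates u (k + 1) σ a) :
    ∃ P : ℝ[X], P ≠ 0 ∧ P.natDegree ≤ k ∧ (∀ x ≤ a, 0 ≤ P.eval x) ∧
      ∀ x, a < x → 0 ≤ -σ * u x * P.eval x := by
  induction k generalizing σ a with
  | zero =>
    refine ⟨1, one_ne_zero, by simp, fun _ _ => by simp, fun x hx => ?_⟩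
    by_contra hlt
    exact h ⟨x, hx, by simp at hlt; linarith, trivial⟩
  | succ k ih =>
    set S : Set ℝ := {x | a < x ∧ 0 < σ * u x} with hS
    rcases S.eq_empty_or_nonempty with hemp | hne
    · refine ⟨1, one_ne_zero, by simp, fun _ _ => by simp, fun x hx => ?_⟩
      by_contra hlt
      have : x ∈ S := ⟨hx, by simp at hlt; linarith⟩
      simp [hemp] at this
    have hbdd : BddBelow S := ⟨a, fun x hx => hx.1.le⟩
    have hab : a ≤ sInf S := le_csInf hne fun x hx => hx.1.le
    obtain ⟨P, hP0, hPd, hPn, hPp⟩ := ih (σ := -σ) (a := sInf S) (by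
      rintro ⟨y, hy, h1, h2⟩
      obtain ⟨x, hx, hxy⟩ := exists_lt_of_csInf_lt hne hy
      exact h ⟨x, hx.1, hx.2, y, hxy, h1, h2⟩)
    refine ⟨(C (sInf S) - X) * P, mul_ne_zero (fun h0 => ?_) hP0, ?_, fun x hx => ?_, fun x hx => ?_⟩
    · have := congrArg natDegree h0
      rw [← neg_sub, natDegree_neg, natDegree_X_sub_C] at this
      simp at this
    · refine natDegree_mul_le.trans ?_
      rw [← neg_sub, natDegree_neg, natDegree_X_sub_C]
      omega
    · rw [eval_mul, eval_sub, eval_C, eval_X]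
      exact mul_nonneg (sub_nonneg.2 (hx.trans hab)) (hPn x (hx.trans hab))
    · rw [eval_mul, eval_sub, eval_C, eval_X]
      rcases le_or_gt x (sInf S) with hle | hlt
      -- At the infimum itself the sign of $\sigma u$ is not known, but the linear factor vanishes
      -- there.
      · rcases hle.eq_or_lt with heq | hlt
        · rw [heq]; simp
        · have hnS : ¬ 0 < σ * u x := fun h1 => notMem_of_lt_csInf hlt hbdd ⟨hx, h1⟩
          refine mul_nonneg (by linarith) (mul_nonneg (sub_nonneg.2 hlt.le) (hPn x hle))
      · have := mul_nonneg (sub_nonneg.2 hlt.le) (hPp x hlt)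
        linarith

/-- Of the two chains, the one that starts first lends its first point to the other; the starting
points differ because $u$ has opposite signs there. -/
theorem Alternates.of_both {u : ℝ → ℝ} {k : ℕ} {a : ℝ} (h1 : Alternates u (k + 1) 1 a)
    (h2 : Alternates u (k + 1) (-1) a) : ∃ σ, Alternates u (k + 2) σ a := by
  obtain ⟨x, hx, hux, hx'⟩ := h1
  obtain ⟨y, hy, huy, hy'⟩ := h2
  rcases lt_trichotomy x y with hxy | rfl | hxy
  · exact ⟨1, x, hx, hux, y, hxy, huy, hy'⟩
  · linarith
  · exact ⟨-1, y, hy, huy, x, hxy, by simpa using hux, by simpa using hx'⟩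

theorem exists_deriv_sign {u g : ℝ → ℝ} (hu : ∀ x, 0 < x → HasDerivAt u (g x) x) {σ x y : ℝ}
    (hx : 0 < x) (hxy : x < y) (h : σ * u x < σ * u y) : ∃ c, x < c ∧ c < y ∧ 0 < σ * g c := by
  obtain ⟨c, hc, he⟩ := exists_hasDerivAt_eq_slope u g hxy
    (fun z hz => (hu z (hx.trans_le hz.1)).continuousAt.continuousWithinAt)
    (fun z hz => hu z (hx.trans hz.1))
  refine ⟨c, hc.1, hc.2, ?_⟩
  rw [he, ← mul_div_assoc]
  exact div_pos (by linarith) (sub_pos.2 hxy)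

/-- The mean value theorem between consecutive points of the chain. -/
theorem Alternates.deriv {u g : ℝ → ℝ} (hu : ∀ x, 0 < x → HasDerivAt u (g x) x) {k : ℕ}
    {σ x : ℝ} (hx : 0 < x) (h0 : 0 < σ * u x) (h : Alternates u k (-σ) x) :
    Alternates g k (-σ) x := by
  induction k generalizing σ x with
  | zero => trivial
  | succ k ih =>
    obtain ⟨y, hxy, h1, h2⟩ := h
    obtain ⟨c, hc1, hc2, hc⟩ := exists_deriv_sign hu (σ := -σ) hx hxy (by linarith)
    exact ⟨c, hc1, hc, (ih (hx.trans hxy) h1 h2).mono hc2.le⟩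

theorem Alternates.le_card_roots {q : ℝ[X]} (hq : q ≠ 0) {k : ℕ} {σ x : ℝ}
    (h0 : 0 < σ * q.eval x) (h : Alternates (fun x => q.eval x) k (-σ) x) :
    k ≤ (q.roots.toFinset.filter (x < ·)).card := by
  induction k generalizing σ x with
  | zero => exact Nat.zero_le _
  | succ k ih =>
    obtain ⟨y, hxy, h1, h2⟩ := h
    obtain ⟨z, hz, hz0⟩ : ∃ z ∈ Ioo x y, σ * q.eval z = 0 :=
      intermediate_value_Ioo' hxy.le (f := fun z => σ * q.eval z)
        (by have := q.continuous; fun_prop) ⟨by simpa using h1, h0⟩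
    have hσ : σ ≠ 0 := fun h => by simp [h] at h0
    have hzr : q.eval z = 0 := (mul_eq_zero.1 hz0).resolve_left hσ
    have hsub : insert z (q.roots.toFinset.filter (y < ·)) ⊆ q.roots.toFinset.filter (x < ·) := by
      intro t ht
      rcases Finset.mem_insert.1 ht with rfl | ht
      · simp [hq, hzr, hz.1]
      · rw [Finset.mem_filter] at ht ⊢
        exact ⟨ht.1, hxy.trans ht.2⟩
    refine le_trans ?_ (Finset.card_le_card hsub)
    rw [Finset.card_insert_of_notMem (by simp [hz.2.le])]
    exact Nat.succ_le_succ (ih h1 h2)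

theorem Alternates.le_natDegree {q : ℝ[X]} {k : ℕ} {σ a : ℝ}
    (h : Alternates (fun x => q.eval x) (k + 1) σ a) : k ≤ q.natDegree := by
  obtain ⟨x, -, h1, h2⟩ := h
  have hq : q ≠ 0 := fun h => by simp [h] at h1
  exact (Alternates.le_card_roots hq h1 h2).trans ((Finset.card_filter_le _ _).trans
    ((Multiset.toFinset_card_le _).trans (card_roots' q)))

/-! ### Nondegeneracy of `⟨ψ_j, ε ψ_k⟩` -/

/-- Otherwise some nonzero $P$ of degree $\le n$ makes $-\sigma uP$ nonnegative, where
$u=\varepsilon(q\sqrt w)$. By orthogonality its integral against $\sqrt w$ is zero, so $u$ vanishes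
almost everywhere, hence everywhere by continuity, and so does its derivative $q\sqrt w$. -/
theorem Admissible.alternates_eps (h : Admissible α V) {n : ℕ} {q : ℝ[X]} (hq : q ≠ 0)
    (h0 : ∀ r ∈ degreeLT ℝ (n + 1), h.epsForm (X * q) (X * r) = 0) {σ : ℝ} (hσ : σ ≠ 0) :
    Alternates (eps (withWeightDiv α V (X * q))) (n + 1) σ 0 := by
  by_contra hnot
  obtain ⟨P, hP0, hPd, -, hP⟩ := exists_poly_of_not_alternates hnot
  set u := eps (withWeightDiv α V (X * q)) with hu
  have hPm : P ∈ degreeLT ℝ (n + 1) := by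
    rw [mem_degreeLT]
    exact lt_of_le_of_lt degree_le_natDegree (by exact_mod_cast Nat.lt_succ_of_le hPd)
  have hint : ∫ x in Ioi (0 : ℝ), -σ * (u x * withWeightDiv α V (X * P) x) = 0 := by
    rw [integral_const_mul]
    exact mul_eq_zero_of_right _ (h0 P hPm)
  have hnn : ∀ x, 0 < x → 0 ≤ -σ * (u x * withWeightDiv α V (X * P) x) := fun x hx => by
    rw [← withWeight_eq hx.ne', withWeight]
    have := mul_nonneg (hP x hx) (Real.sqrt_nonneg (weight α V x))
    linarith
  have hae := (setIntegral_eq_zero_iff_of_nonneg_ae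
    ((ae_restrict_iff' measurableSet_Ioi).2 (.of_forall hnn))
    ((h.integrableOn_eps_mul (X * q) (X * P)).const_mul _)).1 hint
  have hroots : ∀ᵐ x ∂volume.restrict (Ioi (0 : ℝ)), x ∉ (P.roots.toFinset : Set ℝ) :=
    ae_restrict_of_ae ((Finset.countable_toSet _).ae_notMem _)
  have huae : u =ᵐ[volume.restrict (Ioi 0)] fun _ => (0 : ℝ) := by
    filter_upwards [hae, hroots, ae_restrict_mem measurableSet_Ioi] with x h1 h2 h3
    have hx : (0 : ℝ) < x := h3
    have hPx : P.eval x ≠ 0 := fun h => h2 (by simp [hP0, h])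
    rw [← withWeight_eq hx.ne', withWeight] at h1
    simpa [hσ, hPx, (Real.sqrt_pos.2 (weight_pos α V hx)).ne'] using h1
  have hu0 : EqOn u (fun _ => 0) (Ioi 0) := Measure.eqOn_open_of_ae_eq huae isOpen_Ioi
    (h.hasIntegrableDeriv_eps _).continuousOn continuousOn_const
  have hXq : X * q = 0 := withWeightDiv_injective (α := α) (V := V) fun x hx => by
    have hd := (h.hasIntegrableDeriv_eps (X * q)).hasDerivAt x hx
    have hz : HasDerivAt u 0 x := (hasDerivAt_const x (0 : ℝ)).congr_of_eventuallyEq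
      (hu0.eventuallyEq_of_mem (Ioi_mem_nhds hx))
    rw [hd.unique hz]
    simp [withWeightDiv]
  exact mul_ne_zero X_ne_zero hq hXq

/-- Orthogonality to degree $<n$ gives $u=\varepsilon(q\sqrt w)$ chains of $n$ alternating points
with either initial sign, hence one of $n+1$ points. As $n$ is even, the chain begins and ends with
the same sign, whereas the limits of $u$ at $0$ and $\infty$ are opposite; so one end contributes a
further monotone stretch. Then $u'=q\sqrt w$ alternates at $n+1$ points and $q$ has at least $n$
zeros, although $\deg q<n$. -/
theorem Admissible.eq_zero_of_epsForm (h : Admissible α V) {n : ℕ} (hn : Even n)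
    {q : ℝ[X]} (hq : q ∈ degreeLT ℝ n)
    (h0 : ∀ r ∈ degreeLT ℝ n, h.epsForm (X * q) (X * r) = 0) : q = 0 := by
  by_contra hne
  have hqd : q.natDegree < n := by
    rw [mem_degreeLT, degree_eq_natDegree hne] at hq
    exact_mod_cast hq
  obtain ⟨k, rfl⟩ := Nat.exists_eq_succ_of_ne_zero (by omega : n ≠ 0)
  obtain ⟨σ, hσ⟩ := (h.alternates_eps hne h0 one_ne_zero).of_both
    (h.alternates_eps hne h0 (by norm_num))
  set g := withWeightDiv α V (X * q) with hg
  have hd := (h.hasIntegrableDeriv_eps (X * q)).hasDerivAt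
  have hsign : ∀ x, 0 < x → ∀ σ, 0 < σ * g x → 0 < σ * q.eval x := fun x hx σ h1 => by
    rw [hg, ← withWeight_eq hx.ne', withWeight, ← mul_assoc] at h1
    exact pos_of_mul_pos_left h1 (Real.sqrt_nonneg _)
  have hcontra : ∀ σ a, 0 < a → ¬ Alternates g (k + 2) σ a := fun σ a ha hA => by
    have := (hA.of_sign fun x hx => hsign x (ha.trans hx)).le_natDegree
    omega
  have hint := h.integrableOn_withWeightDiv (X * q)
  have t0 := (tendsto_eps_zero hint).const_mul σ
  have t1 := (tendsto_eps_atTop hint).const_mul (-σ)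
  set I := 1 / 2 * ∫ y in Ioi (0 : ℝ), withWeightDiv α V (X * q) y with hI
  -- The limits of $\sigma u$ are $-\sigma I$ at $0$ and $\sigma I$ at $\infty$. If $\sigma I<0$, a
  -- point far to the right prolongs the chain; otherwise $\sigma u$ must increase between $0$ and
  -- the first point of the chain.
  rcases lt_or_ge (σ * I) 0 with hneg | hnonneg
  · have hev : ∀ᶠ x in atTop, 0 < -σ * eps g x :=
      t1.eventually_const_lt (by linarith)
    have hpow : (-1 : ℝ) ^ (k + 2) = -1 := by
      rw [pow_succ, Even.neg_one_pow (show Even (k + 1) from hn), one_mul]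
    obtain ⟨x, hx, h1, h2⟩ := hσ.extend (by simpa only [hpow, neg_one_mul] using hev)
    exact hcontra _ x hx (h2.deriv hd hx h1)
  · obtain ⟨x, hx, h1, h2⟩ := hσ
    have hev : ∀ᶠ y in 𝓝[>] 0, σ * eps g y < σ * eps g x :=
      t0.eventually_lt_const (by linarith)
    obtain ⟨y, hy1, hy2⟩ := (hev.and (Ioo_mem_nhdsGT hx)).exists
    obtain ⟨c, hc1, hc2, hc⟩ := exists_deriv_sign hd hy2.1 hy2.2 hy1
    -- Any positive number below $c$ serves as the left bound of the chain.
    exact hcontra σ (c / 2) (half_pos (hy2.1.trans hc1))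
      ⟨c, half_lt_self (hy2.1.trans hc1), hc, (h2.deriv hd hx h1).mono hc2.le⟩

open Matrix

/-! ### The commutator of `D` and `K` -/

section

variable {b d : ℝ} {n : ℕ}

/-- The kernel identity `(∂_x + ∂_y) K_n(x, y) = Φ(x) A Φ(y)ᵗ` with `A = (0 aᵗ; a 0)`, in terms of
polynomials in `x`, and with an arbitrary linear functional `c` applied in `y`. -/
def IsCommutatorBlock (α : ℝ) (V : ℝ[X]) (b d : ℝ) (n : ℕ)
    (a : Matrix (Fin V.natDegree) (Fin V.natDegree) ℝ) : Prop :=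
  ∀ c : ℝ[X] →ₗ[ℝ] ℝ,
    ∑ k ∈ Finset.range n, (c (X * orthoPoly α V k) • polyDeriv α V (orthoPoly α V k)
        + c (polyDeriv α V (orthoPoly α V k)) • (X * orthoPoly α V k)) =
      ∑ i, (a *ᵥ fun j => c (X * Phi1Poly α V b d n j)) i • Phi2Poly α V b d n i
        + ∑ j, ((fun i => c (Phi2Poly α V b d n i)) ᵥ* a) j • (X * Phi1Poly α V b d n j)

theorem sum_smul_antisymm {M : Type*} [AddCommGroup M] [Module ℝ M] {n : ℕ} {t : ℕ → ℕ → ℝ}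
    (ht : ∀ k l, t k l = -t l k) (c : ℕ → ℝ) (w : ℕ → M) :
    ∑ k ∈ Finset.range n, (c k • ∑ l ∈ Finset.range n, t k l • w l
      + (∑ l ∈ Finset.range n, t k l * c l) • w k) = 0 := by
  rw [Finset.sum_add_distrib]
  simp only [Finset.smul_sum, Finset.sum_smul]
  rw [Finset.sum_comm, ← Finset.sum_add_distrib]
  refine Finset.sum_eq_zero fun k _ => ?_
  rw [← Finset.sum_add_distrib]
  refine Finset.sum_eq_zero fun l _ => ?_
  rw [ht k l, smul_smul, ← add_smul]
  convert zero_smul ℝ (w k) using 2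
  ring

/-- Because $\Phi_2$ is orthogonal to degree $<n$, the part $Xe_k$ of $\delta p_k$ has coefficients
$L(\delta p_k\,p_l)$, which are antisymmetric in $k,l$ and cancel in the symmetric sum. What
survives pairs $\Phi_2$ with the columns $\sum_k\rho_{ki}p_k$, and these are combinations of
$\Phi_1$. -/
theorem Admissible.exists_isCommutatorBlock (h : Admissible α V) (hb : 0 < b) (hd : d ≠ 0)
    (hn : n ≠ 0) : ∃ a, IsCommutatorBlock α V b d n a := by
  obtain ⟨e, ρ, a, he, hdec, ha⟩ := h.exists_polyDeriv_decomposition hb hd hn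
  refine ⟨a, fun c => ?_⟩
  set p := orthoPoly α V with hp
  set t : ℕ → ℕ → ℝ := fun k l => h.moment (X * (e k * p l)) with ht
  have hexp : ∀ k, e k = ∑ l ∈ Finset.range n, t k l • p l := fun k => (h.expansion (he k)).symm
  have htd : ∀ k < n, ∀ l < n, t k l = h.moment (polyDeriv α V (p k) * p l) := by
    intro k hk l hl
    rw [hdec k hk, add_mul, map_add, Finset.sum_mul, map_sum, Finset.sum_eq_zero, add_zero, mul_assoc]
    intro i _
    rw [smul_mul_assoc, map_smul, h.moment_Phi2Poly_mul _ (h.orthoPoly_mem hl), smul_zero]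
  -- These numbers are antisymmetric for all indices, whereas `t` agrees with them only for indices
  -- below $n$.
  set t' : ℕ → ℕ → ℝ := fun k l => h.moment (polyDeriv α V (p k) * p l) with ht'
  have hanti := sum_smul_antisymm (n := n) (t := t')
    (fun k l => h.moment_polyDeriv_antisymm _ _) (fun k => c (X * p k)) (fun k => X * p k)
  have hXe : ∀ k < n, X * e k = ∑ l ∈ Finset.range n, t' k l • (X * p l) := fun k hk => by
    rw [hexp, Finset.mul_sum]
    refine Finset.sum_congr rfl fun l hl => ?_
    rw [mul_smul_comm, htd k hk l (Finset.mem_range.1 hl)]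
  have hterm : ∀ k ∈ Finset.range n, c (X * p k) • polyDeriv α V (p k)
      + c (polyDeriv α V (p k)) • (X * p k) =
      (c (X * p k) • ∑ l ∈ Finset.range n, t' k l • (X * p l)
        + (∑ l ∈ Finset.range n, t' k l * c (X * p l)) • (X * p k)) +
      (∑ i, (ρ k i * c (X * p k)) • Phi2Poly α V b d n i
        + ∑ i, c (Phi2Poly α V b d n i) • (X * ρ k i • p k)) := by
    intro k hk
    rw [hdec k (Finset.mem_range.1 hk), hXe k (Finset.mem_range.1 hk)]
    simp only [map_add, map_sum, map_smul, smul_add, add_smul, Finset.smul_sum, Finset.sum_smul,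
      smul_smul, smul_eq_mul, mul_smul_comm]
    simp only [mul_comm (ρ k _)]
    abel
  rw [Finset.sum_congr rfl hterm, Finset.sum_add_distrib, hanti, zero_add, Finset.sum_add_distrib]
  congr 1
  · rw [Finset.sum_comm]
    refine Finset.sum_congr rfl fun i _ => ?_
    rw [← Finset.sum_smul]
    congr 1
    have := congrArg (fun q => c (X * q)) (ha i)
    simpa only [Finset.mul_sum, map_sum, mul_smul_comm, map_smul, smul_eq_mul, mulVec,
      dotProduct] using this
  · rw [Finset.sum_comm]
    simp only [← Finset.smul_sum, ← Finset.mul_sum, ha]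
    simp only [Matrix.vecMul, dotProduct, Finset.sum_smul, Finset.smul_sum, Finset.mul_sum,
      mul_smul_comm, smul_smul]
    rw [Finset.sum_comm]

/-- The pairing with a function `f`, as a linear functional on polynomials. -/
def Admissible.ipL (h : Admissible α V) {f f' : ℝ → ℝ} (hf : HasIntegrableDeriv f f') :
    ℝ[X] →ₗ[ℝ] ℝ where
  toFun q := ip f (withWeightDiv α V q)
  map_add' q r := by
    simp only [ip]
    rw [← integral_add (hf.integrableOn_mul (h.integrableOn_withWeightDiv q))
      (hf.integrableOn_mul (h.integrableOn_withWeightDiv r))]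
    congr 1; ext x
    simp only [withWeightDiv, eval_add]; ring
  map_smul' c q := by
    simp only [ip]
    rw [RingHom.id_apply, smul_eq_mul, ← integral_const_mul]
    congr 1; ext x
    simp only [withWeightDiv, eval_smul, smul_eq_mul]; ring

theorem Admissible.ipL_apply (h : Admissible α V) {f f' : ℝ → ℝ} (hf : HasIntegrableDeriv f f')
    (q : ℝ[X]) : h.ipL hf q = ip f (withWeightDiv α V q) := rfl

theorem opK_eq {f : ℝ → ℝ} (hf : ∀ k, IntegrableOn (fun y => phi α V k y * f y) (Ioi 0)) (x : ℝ) :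
    opK α V n f x = ∑ k ∈ Finset.range n, phi α V k x * ip (phi α V k) f := by
  simp only [opK, kernelK, Finset.sum_mul, mul_assoc]
  rw [integral_finsetSum _ fun k _ => (hf k).const_mul _]
  simp only [integral_const_mul, ip]

/-- Integration by parts moves the derivative from $f$ to $\phi_k$, so $DK-KD$ has the kernel
$(\partial_x+\partial_y)K_n$. -/
theorem Admissible.commutator_eq (h : Admissible α V) {f : ℝ → ℝ}
    (hf : HasIntegrableDeriv f (deriv f)) {x : ℝ} (hx : 0 < x) :
    deriv (opK α V n f) x - opK α V n (deriv f) x =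
      withWeightDivL α V x (∑ k ∈ Finset.range n,
        (h.ipL hf (X * orthoPoly α V k) • polyDeriv α V (orthoPoly α V k)
          + h.ipL hf (polyDeriv α V (orthoPoly α V k)) • (X * orthoPoly α V k))) := by
  have e1 : opK α V n f = fun x => ∑ k ∈ Finset.range n, phi α V k x * ip (phi α V k) f :=
    funext fun x => opK_eq (fun k => by
      refine (hf.integrableOn_mul (h.integrableOn_withWeightDiv (X * orthoPoly α V k))).congr_fun
        (fun y hy => ?_) measurableSet_Ioi
      simp only [phi]
      rw [withWeight_eq (ne_of_gt hy), mul_comm]) x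
  have e2 := opK_eq (α := α) (V := V) (n := n) (f := deriv f)
    (fun k => (h.hasIntegrableDeriv_withWeight _).integrableOn_mul hf.integrableOn) x
  have e3 : HasDerivAt (opK α V n f) (∑ k ∈ Finset.range n,
      withWeightDiv α V (polyDeriv α V (orthoPoly α V k)) x * ip (phi α V k) f) x := by
    rw [e1]
    exact HasDerivAt.fun_sum fun k _ => (hasDerivAt_withWeight _ hx).mul_const _
  rw [e3.deriv, e2, map_sum, ← Finset.sum_sub_distrib]
  refine Finset.sum_congr rfl fun k _ => ?_
  have e4 : ip (phi α V k) f = h.ipL hf (X * orthoPoly α V k) := by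
    rw [h.ipL_apply, ip_comm]
    exact ip_congr (fun _ _ => rfl) fun y hy => withWeight_eq hy.ne' _
  have e5 : ip (phi α V k) (deriv f) = -h.ipL hf (polyDeriv α V (orthoPoly α V k)) := by
    rw [h.ipL_apply, ip_comm f]
    exact h.ip_withWeight_deriv _ hf
  rw [e4, e5, map_add, map_smul, map_smul, phi, withWeight_eq hx.ne']
  simp only [withWeightDivL, LinearMap.coe_mk, AddHom.coe_mk, smul_eq_mul]
  ring

theorem hasIntegrableDeriv_of_contDiffOn {f : ℝ → ℝ} (hf : ContDiffOn ℝ 1 f (Ioi 0))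
    (hi : IntegrableOn (deriv f) (Ioi 0)) : HasIntegrableDeriv f (deriv f) :=
  ⟨fun _ hx => ((hf.differentiableOn one_ne_zero).differentiableAt (Ioi_mem_nhds hx)).hasDerivAt, hi⟩

theorem withWeightDivL_apply (x : ℝ) (q : ℝ[X]) :
    withWeightDivL α V x q = withWeightDiv α V q x := rfl

theorem Admissible.isCommutatorMatrix (h : Admissible α V) (hn : n ≠ 0)
    {a : Matrix (Fin V.natDegree) (Fin V.natDegree) ℝ} (ha : IsCommutatorBlock α V b d n a) :
    IsCommutatorMatrix α V b d n (fromBlocks 0 aᵀ a 0) := by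
  intro f hf hi x hx
  have hf' := hasIntegrableDeriv_of_contDiffOn hf hi
  have hip : ∀ j, ip f (Phi α V b d n j) = h.ipL hf' (PhiPoly α V b d n j) := fun j => by
    rw [h.ipL_apply]
    exact ip_congr (fun _ _ => rfl) fun y hy => h.Phi_eq hn j hy.ne'
  rw [h.commutator_eq hf' hx, ha]
  simp only [hip, h.Phi_eq hn _ hx.ne', Fintype.sum_sum_type, fromBlocks_apply₁₁, fromBlocks_apply₁₂,
    fromBlocks_apply₂₁, fromBlocks_apply₂₂, Matrix.zero_apply, mul_zero, zero_mul,
    Finset.sum_const_zero, zero_add, add_zero, PhiPoly, Sum.elim_inl, Sum.elim_inr, map_add, map_sum,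
    map_smul, smul_eq_mul, mulVec, vecMul, dotProduct, Matrix.transpose_apply, withWeightDivL_apply]
  rw [add_comm]
  congr 1
  · refine Finset.sum_congr rfl fun i _ => ?_
    rw [Finset.sum_mul]
    exact Finset.sum_congr rfl fun j _ => by ring
  · refine Finset.sum_congr rfl fun i _ => ?_
    rw [Finset.sum_mul]
    exact Finset.sum_congr rfl fun j _ => by ring

theorem contDiffOn_withWeight (q : ℝ[X]) : ContDiffOn ℝ 1 (withWeight α V q) (Ioi 0) := by
  intro x hx
  have hx' : x ≠ 0 := ne_of_gt hx
  have hp : ∀ p : ℝ[X], ContDiff ℝ 1 fun x => p.eval x := fun p => by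
    simpa using p.contDiff_aeval (𝕜 := ℝ) 1
  have h1 : ContDiffAt ℝ 1 (weight α V) x :=
    (Real.contDiffAt_rpow_const_of_ne hx').mul ((hp V).contDiffAt.neg.exp)
  exact ((hp q).contDiffAt.mul (h1.sqrt (weight_pos α V hx).ne')).contDiffWithinAt

theorem Admissible.integrableOn_deriv_withWeight (h : Admissible α V) (q : ℝ[X]) :
    IntegrableOn (deriv (withWeight α V q)) (Ioi 0) :=
  (h.integrableOn_withWeightDiv (polyDeriv α V q)).congr_fun
    (fun _ hx => (hasDerivAt_withWeight q hx).deriv.symm) measurableSet_Ioi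

/-- Test with $f=q\sqrt w$. Independence of $\Phi$ in $x$ shows that each row of $A-A'$, combined
with $\Phi$, gives a polynomial $\omega$ with $L(q\omega)=0$ for all $q$; the choice $q=X\omega$
forces $\omega=0$. Independence is then used a second time. -/
theorem Admissible.isCommutatorMatrix_unique (h : Admissible α V) (hb : 0 < b) (hd : d ≠ 0)
    (hn : n ≠ 0) (hmn : V.natDegree ≤ n) {A A' : BlockMat V.natDegree}
    (hA : IsCommutatorMatrix α V b d n A) (hA' : IsCommutatorMatrix α V b d n A') : A = A' := by
  have hip : ∀ q j, ip (withWeight α V q) (Phi α V b d n j) = h.moment (q * PhiPoly α V b d n j) :=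
    fun q j => by
      rw [← h.ip_withWeight]
      exact ip_congr (fun _ _ => rfl) fun y hy => h.Phi_eq hn j hy.ne'
  have h1 : ∀ q i, h.moment (q * ∑ j, (A i j - A' i j) • PhiPoly α V b d n j) = 0 := by
    intro q i
    have h2 : ∑ i, h.moment (q * ∑ j, (A i j - A' i j) • PhiPoly α V b d n j) •
        PhiPoly α V b d n i = 0 := by
      refine withWeightDiv_injective (α := α) (V := V) fun x hx => ?_
      have h3 := hA _ (contDiffOn_withWeight q) (h.integrableOn_deriv_withWeight q) x hx
      rw [hA' _ (contDiffOn_withWeight q) (h.integrableOn_deriv_withWeight q) x hx, ← sub_eq_zero,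
        ← Finset.sum_sub_distrib] at h3
      rw [← withWeightDivL_apply, ← withWeightDivL_apply, map_zero, map_sum, ← neg_eq_zero.2 h3,
        ← Finset.sum_neg_distrib]
      refine Finset.sum_congr rfl fun i _ => ?_
      rw [← Finset.sum_sub_distrib, ← Finset.sum_neg_distrib, map_smul, Finset.mul_sum, map_sum,
        Finset.sum_smul]
      refine Finset.sum_congr rfl fun j _ => ?_
      rw [hip, h.Phi_eq hn i hx.ne', mul_smul_comm, map_smul, withWeightDivL_apply]
      simp only [smul_eq_mul]
      ring
    exact congrFun (h.sum_PhiPoly_eq_zero hb hd hn hmn h2) i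
  ext i j
  set w := ∑ j, (A i j - A' i j) • PhiPoly α V b d n j with hw
  have hw0 : w = 0 := by
    by_contra hne
    have h2 := h1 (X * w) i
    rw [mul_assoc] at h2
    exact (h.moment_sq_pos hne).ne' h2
  exact sub_eq_zero.1 (congrFun (h.sum_PhiPoly_eq_zero hb hd hn hmn (hw ▸ hw0)) j)

/-! ### Matrix identities -/

theorem isUnit_of_vecMul {m : ℕ} {M : Matrix (Fin m) (Fin m) ℝ}
    (h : ∀ v, v ᵥ* M = 0 → v = 0) : IsUnit M := by
  rw [isUnit_iff_isUnit_det, isUnit_iff_ne_zero, ne_eq, ← exists_vecMul_eq_zero_iff]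
  rintro ⟨v, hv, h0⟩
  exact hv (h v h0)

theorem isUnit_of_mulVec {m : ℕ} {M : Matrix (Fin m) (Fin m) ℝ}
    (h : ∀ v, M *ᵥ v = 0 → v = 0) : IsUnit M := by
  rw [isUnit_iff_isUnit_det, isUnit_iff_ne_zero, ne_eq, ← exists_mulVec_eq_zero_iff]
  rintro ⟨v, hv, h0⟩
  exact hv (h v h0)

theorem inv_mul_eq_mul_inv {m : ℕ} {M N S : Matrix (Fin m) (Fin m) ℝ} (hM : IsUnit M)
    (hN : IsUnit N) (h : M * S = S * N) : M⁻¹ * S = S * N⁻¹ := by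
  have h1 := (isUnit_iff_isUnit_det M).1 hM
  have h2 := (isUnit_iff_isUnit_det N).1 hN
  calc M⁻¹ * S = M⁻¹ * (S * N) * N⁻¹ := by
        rw [Matrix.mul_assoc, Matrix.mul_assoc, mul_nonsing_inv _ h2, Matrix.mul_one]
    _ = S * N⁻¹ := by rw [← h, ← Matrix.mul_assoc, nonsing_inv_mul _ h1, Matrix.one_mul]

theorem sum_smul_sum_smul {M : Type*} [AddCommGroup M] [Module ℝ M] {m m' : ℕ} (v : Fin m → ℝ)
    (T : Matrix (Fin m) (Fin m') ℝ) (w : Fin m' → M) :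
    ∑ i, v i • ∑ j, T i j • w j = ∑ j, (v ᵥ* T) j • w j := by
  simp only [vecMul, dotProduct, Finset.smul_sum, Finset.sum_smul, smul_smul]
  rw [Finset.sum_comm]

theorem map_sum_vecMul (c : ℝ[X] →ₗ[ℝ] ℝ) {m m' : ℕ} (v : Fin m → ℝ)
    (T : Matrix (Fin m) (Fin m') ℝ) (w : Fin m' → ℝ[X]) :
    c (∑ j, (v ᵥ* T) j • w j) = v ⬝ᵥ (T *ᵥ fun j => c (w j)) := by
  simp only [map_sum, map_smul, smul_eq_mul]
  rw [dotProduct_mulVec]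
  rfl

theorem sandwich_eq {m : ℕ} (F : Fin m → ℝ → ℝ) (T : Matrix (Fin m) (Fin m) ℝ)
    (H : Fin m → ℝ → ℝ) (x y : ℝ) :
    sandwich F T H x y = (fun i => F i x) ⬝ᵥ (T *ᵥ fun j => eps (H j) y) := by
  simp only [sandwich, dotProduct, mulVec, Finset.mul_sum, mul_assoc]

/-! ### The matrices `B` and `C` -/

theorem Admissible.eps_Phi (h : Admissible α V) (hn : n ≠ 0)
    (i : Fin V.natDegree ⊕ Fin V.natDegree) (y : ℝ) :
    eps (Phi α V b d n i) y = h.epsL y (PhiPoly α V b d n i) :=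
  congrFun (eps_congr fun _ hx => h.Phi_eq hn i hx.ne') y

theorem Admissible.matB_apply (h : Admissible α V) (hn : n ≠ 0)
    (i j : Fin V.natDegree ⊕ Fin V.natDegree) :
    matB α V b d n i j = h.epsForm (PhiPoly α V b d n i) (PhiPoly α V b d n j) := by
  rw [h.epsForm_apply, matB, of_apply]
  exact ip_congr (fun y _ => h.eps_Phi hn i y) fun y hy => h.Phi_eq hn j hy.ne'

theorem Admissible.matB_transpose (h : Admissible α V) (hn : n ≠ 0) :
    (matB α V b d n)ᵀ = -matB α V b d n := by
  ext i j
  rw [transpose_apply, Matrix.neg_apply, h.matB_apply hn, h.matB_apply hn, h.epsForm_antisymm]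

theorem matC_eq (a : Matrix (Fin V.natDegree) (Fin V.natDegree) ℝ) :
    matC α V b d n (fromBlocks 0 aᵀ a 0) =
      fromBlocks (1 + (matB α V b d n).toBlocks₁₂ * a) ((matB α V b d n).toBlocks₁₁ * aᵀ)
        ((matB α V b d n).toBlocks₂₂ * a) ((matB α V b d n).toBlocks₂₁ * aᵀ) := by
  rw [matC]
  conv_lhs => rw [← fromBlocks_toBlocks (matB α V b d n)]
  rw [fromBlocks_multiply, fromBlocks_add]
  simp

/-- The polynomial `r` with `K ε (q √w / x) = r √w`. -/
def Admissible.projEps (h : Admissible α V) (n : ℕ) (q : ℝ[X]) : ℝ[X] :=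
  ∑ k ∈ Finset.range n, h.epsForm q (X * orthoPoly α V k) • orthoPoly α V k

theorem Admissible.projEps_mem (h : Admissible α V) (q : ℝ[X]) :
    h.projEps n q ∈ degreeLT ℝ n :=
  Submodule.sum_mem _ fun _ hk => Submodule.smul_mem _ _ (h.orthoPoly_mem (Finset.mem_range.1 hk))

theorem Admissible.moment_projEps_mul (h : Admissible α V) (q : ℝ[X]) {r : ℝ[X]}
    (hr : r ∈ degreeLT ℝ n) : h.moment (X * (h.projEps n q * r)) = h.epsForm q (X * r) := by
  conv_rhs => rw [← h.expansion hr]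
  simp only [Admissible.projEps, Finset.sum_mul, Finset.mul_sum, map_sum, smul_mul_assoc,
    mul_smul_comm, map_smul, smul_eq_mul]
  exact Finset.sum_congr rfl fun k _ => by rw [mul_comm r, mul_comm (h.moment _)]

variable {a : Matrix (Fin V.natDegree) (Fin V.natDegree) ℝ}

/-- This is $DK\varepsilon=KD\varepsilon+[D,K]\varepsilon=K+\Phi
A\langle\varepsilon\,\cdot,\Phi^t\rangle$. The kernel identity is applied to the functional
$\langle\varepsilon(q\sqrt w/x),\cdot\rangle$. -/
theorem Admissible.polyDeriv_projEps (h : Admissible α V) (ha : IsCommutatorBlock α V b d n a)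
    (q : ℝ[X]) : polyDeriv α V (h.projEps n q) = X * h.proj n q
      + ∑ i, (a *ᵥ fun j => h.epsForm q (X * Phi1Poly α V b d n j)) i • Phi2Poly α V b d n i
      + ∑ j, ((fun i => h.epsForm q (Phi2Poly α V b d n i)) ᵥ* a) j •
          (X * Phi1Poly α V b d n j) := by
  rw [add_assoc, ← ha (h.epsForm q), Finset.sum_add_distrib, Admissible.projEps, map_sum,
    h.proj_apply, Finset.mul_sum, add_left_comm, ← Finset.sum_add_distrib]
  simp only [map_smul]
  rw [left_eq_add]
  refine Finset.sum_eq_zero fun k _ => ?_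
  rw [mul_smul_comm, ← add_smul, h.epsForm_antisymm q, h.epsForm_polyDeriv, mul_comm q,
    add_neg_cancel, zero_smul]

theorem Admissible.proj_Phi2Poly (h : Admissible α V) (i : Fin V.natDegree) :
    h.proj n (Phi2Poly α V b d n i) = 0 := by
  rw [h.proj_apply]
  exact Finset.sum_eq_zero fun k hk => by
    rw [h.moment_Phi2Poly_mul i (h.orthoPoly_mem (Finset.mem_range.1 hk)), zero_smul]

/-- The upper half of $DK\varepsilon\Phi^t=C\Phi^t$. Here $K\Phi_1=\Phi_1$ accounts for the identity
block in the definition of $C$. -/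
theorem Admissible.polyDeriv_projEps_Phi1 (h : Admissible α V) (hn : n ≠ 0)
    (ha : IsCommutatorBlock α V b d n a) (i : Fin V.natDegree) :
    polyDeriv α V (h.projEps n (X * Phi1Poly α V b d n i)) =
      ∑ j, (matC α V b d n (fromBlocks 0 aᵀ a 0)).toBlocks₁₁ i j • (X * Phi1Poly α V b d n j)
      + ∑ j, (matC α V b d n (fromBlocks 0 aᵀ a 0)).toBlocks₁₂ i j • Phi2Poly α V b d n j := by
  have h1 : ∀ j, (matB α V b d n).toBlocks₁₁ i j =
    h.epsForm (X * Phi1Poly α V b d n i) (X * Phi1Poly α V b d n j) := fun j => h.matB_apply hn _ _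
  have h2 : ∀ j, (matB α V b d n).toBlocks₁₂ i j =
    h.epsForm (X * Phi1Poly α V b d n i) (Phi2Poly α V b d n j) := fun j => h.matB_apply hn _ _
  rw [h.polyDeriv_projEps ha, h.proj_X_mul (h.Phi1Poly_mem hn i), matC_eq, toBlocks_fromBlocks₁₁,
    toBlocks_fromBlocks₁₂, add_right_comm]
  congr 1
  · simp only [Matrix.add_apply, add_smul, Finset.sum_add_distrib, Matrix.one_apply, ite_smul, one_smul,
      zero_smul, Finset.sum_ite_eq, Finset.mem_univ, if_true, Matrix.mul_apply, vecMul, dotProduct, h2]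
  · simp only [Matrix.mul_apply, mulVec, dotProduct, h1, transpose_apply, mul_comm (a _ _)]

/-- The lower half of $DK\varepsilon\Phi^t=C\Phi^t$. Here $K\Phi_2=0$ accounts for the zero block in
the definition of $C$. -/
theorem Admissible.polyDeriv_projEps_Phi2 (h : Admissible α V) (hn : n ≠ 0)
    (ha : IsCommutatorBlock α V b d n a) (i : Fin V.natDegree) :
    polyDeriv α V (h.projEps n (Phi2Poly α V b d n i)) =
      ∑ j, (matC α V b d n (fromBlocks 0 aᵀ a 0)).toBlocks₂₁ i j • (X * Phi1Poly α V b d n j)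
      + ∑ j, (matC α V b d n (fromBlocks 0 aᵀ a 0)).toBlocks₂₂ i j • Phi2Poly α V b d n j := by
  have h1 : ∀ j, (matB α V b d n).toBlocks₂₁ i j =
    h.epsForm (Phi2Poly α V b d n i) (X * Phi1Poly α V b d n j) := fun j => h.matB_apply hn _ _
  have h2 : ∀ j, (matB α V b d n).toBlocks₂₂ i j =
    h.epsForm (Phi2Poly α V b d n i) (Phi2Poly α V b d n j) := fun j => h.matB_apply hn _ _
  rw [h.polyDeriv_projEps ha, h.proj_Phi2Poly, matC_eq, toBlocks_fromBlocks₂₁,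
    toBlocks_fromBlocks₂₂, mul_zero, zero_add, add_comm]
  congr 1
  · simp only [Matrix.mul_apply, vecMul, dotProduct, h2]
  · simp only [Matrix.mul_apply, mulVec, dotProduct, h1, transpose_apply, mul_comm (a _ _)]

theorem Admissible.epsForm_polyDeriv_projEps_Phi1 (h : Admissible α V) (hn : n ≠ 0) (q : ℝ[X])
    (j : Fin V.natDegree) : h.epsForm (polyDeriv α V (h.projEps n q)) (X * Phi1Poly α V b d n j) =
      h.epsForm q (X * Phi1Poly α V b d n j) := by
  rw [h.epsForm_polyDeriv, mul_left_comm, h.moment_projEps_mul q (h.Phi1Poly_mem hn j)]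

theorem Admissible.epsForm_polyDeriv_projEps_Phi2 (h : Admissible α V) (q : ℝ[X])
    (j : Fin V.natDegree) :
    h.epsForm (polyDeriv α V (h.projEps n q)) (Phi2Poly α V b d n j) = 0 := by
  rw [h.epsForm_polyDeriv, mul_comm, h.moment_Phi2Poly_mul j (h.projEps_mem q)]

/-- Pair $DK\varepsilon\Phi_1$ with $\Phi_1$ under $\varepsilon$: as $\varepsilon D=1$ and
$K\Phi_1=\Phi_1$, the result is $\langle\varepsilon\Phi_1^t,\Phi_1\rangle$. -/
theorem Admissible.blocks₁₁_eq (h : Admissible α V) (hn : n ≠ 0)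
    (ha : IsCommutatorBlock α V b d n a) :
    (matC α V b d n (fromBlocks 0 aᵀ a 0)).toBlocks₁₁ * (matB α V b d n).toBlocks₁₁
      + (matC α V b d n (fromBlocks 0 aᵀ a 0)).toBlocks₁₂ * (matB α V b d n).toBlocks₂₁ =
      (matB α V b d n).toBlocks₁₁ := by
  ext i j
  have h1 := h.epsForm_polyDeriv_projEps_Phi1 (b := b) (d := d) hn (X * Phi1Poly α V b d n i) j
  rw [h.polyDeriv_projEps_Phi1 hn ha i] at h1
  simp only [map_add, map_sum, map_smul, LinearMap.add_apply, LinearMap.sum_apply,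
    LinearMap.smul_apply, smul_eq_mul] at h1
  have hB : ∀ i j, matB α V b d n i j = _ := fun i j => h.matB_apply hn i j
  simp only [Matrix.add_apply, Matrix.mul_apply, toBlocks₁₁, toBlocks₂₁, of_apply] at h1 ⊢
  simp only [hB, PhiPoly, Sum.elim_inl, Sum.elim_inr]
  exact h1

/-- Pair $DK\varepsilon\Phi_2$ with $\Phi_2$ under $\varepsilon$: as $\varepsilon D=1$ and
$K\Phi_2=0$, nothing is left. -/
theorem Admissible.blocks₂₂_eq (h : Admissible α V) (hn : n ≠ 0)
    (ha : IsCommutatorBlock α V b d n a) :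
    (matC α V b d n (fromBlocks 0 aᵀ a 0)).toBlocks₂₁ * (matB α V b d n).toBlocks₁₂
      + (matC α V b d n (fromBlocks 0 aᵀ a 0)).toBlocks₂₂ * (matB α V b d n).toBlocks₂₂ = 0 := by
  ext i j
  have h1 := h.epsForm_polyDeriv_projEps_Phi2 (n := n) (b := b) (d := d) (Phi2Poly α V b d n i) j
  rw [h.polyDeriv_projEps_Phi2 hn ha i] at h1
  simp only [map_add, map_sum, map_smul, LinearMap.add_apply, LinearMap.sum_apply,
    LinearMap.smul_apply, smul_eq_mul] at h1
  have hB : ∀ i j, matB α V b d n i j = _ := fun i j => h.matB_apply hn i j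
  simp only [Matrix.add_apply, Matrix.mul_apply, toBlocks₂₂, toBlocks₁₂, of_apply, Matrix.zero_apply] at h1 ⊢
  simp only [hB, PhiPoly, Sum.elim_inl, Sum.elim_inr]
  exact h1

/-! ### Invertibility of `C₁₁` and `Ĉ₂₂` -/

/-- If $vC_{11}=0$ and $f=\Phi_1v^t$, then $D(K\varepsilon f)$ is a combination of $\Phi_2$, hence
orthogonal to the range of $K$. Nondegeneracy for $D$ gives $K\varepsilon f=0$, nondegeneracy for
$\varepsilon$ gives $f=0$, and independence gives $v=0$. -/
theorem Admissible.isUnit_matC₁₁ (h : Admissible α V) (hb : 0 < b) (hd : d ≠ 0) (hn : n ≠ 0)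
    (hmn : V.natDegree ≤ n) (he : Even n) (ha : IsCommutatorBlock α V b d n a) :
    IsUnit (matC α V b d n (fromBlocks 0 aᵀ a 0)).toBlocks₁₁ := by
  refine isUnit_of_vecMul fun v hv => ?_
  set f := ∑ i, v i • Phi1Poly α V b d n i with hf
  set g := ∑ i, v i • h.projEps n (X * Phi1Poly α V b d n i) with hg
  have hgm : g ∈ degreeLT ℝ n :=
    Submodule.sum_mem _ fun i _ => Submodule.smul_mem _ _ (h.projEps_mem _)
  have hfm : f ∈ degreeLT ℝ n :=
    Submodule.sum_mem _ fun i _ => Submodule.smul_mem _ _ (h.Phi1Poly_mem hn i)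
  have hdg : polyDeriv α V g = ∑ j, (v ᵥ* (matC α V b d n (fromBlocks 0 aᵀ a 0)).toBlocks₁₂) j •
      Phi2Poly α V b d n j := by
    simp only [hg, map_sum, map_smul, h.polyDeriv_projEps_Phi1 hn ha, smul_add,
      Finset.sum_add_distrib, sum_smul_sum_smul, hv, Pi.zero_apply, zero_smul,
      Finset.sum_const_zero, zero_add]
  have hg0 : g = 0 := h.eq_zero_of_moment_polyDeriv he hgm fun r hr => by
    rw [hdg, Finset.sum_mul, map_sum]
    exact Finset.sum_eq_zero fun j _ => by
      rw [smul_mul_assoc, map_smul, h.moment_Phi2Poly_mul j hr, smul_zero]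
  refine h.sum_Phi1Poly_eq_zero hb hd hn hmn
    (h.eq_zero_of_epsForm he hfm fun r hr => ?_)
  have h1 : h.moment (X * (g * r)) = h.epsForm (X * f) (X * r) := by
    simp only [hg, hf, Finset.sum_mul, Finset.mul_sum, smul_mul_assoc, mul_smul_comm, map_sum,
      map_smul, LinearMap.sum_apply, LinearMap.smul_apply, h.moment_projEps_mul _ hr]
  rw [← h1, hg0, zero_mul, mul_zero, map_zero]

/-- If $vC_{22}=v$, put $f=\Phi_2v^t$ and $g=K\varepsilon f$. Then $Dg=e+f$ with $e$ in the span of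
$\Phi_1$. Applying $K\varepsilon$ gives $g=K\varepsilon e+g$, so $e=0$ by nondegeneracy for
$\varepsilon$. Now $Dg=f$ is orthogonal to the range of $K$, so $g=0$ by nondegeneracy for $D$, and
$f=Dg=0$. -/
theorem Admissible.isUnit_matCHat₂₂ (h : Admissible α V) (hb : 0 < b) (hd : d ≠ 0) (hn : n ≠ 0)
    (he : Even n) (ha : IsCommutatorBlock α V b d n a) :
    IsUnit (matCHat22 α V b d n (fromBlocks 0 aᵀ a 0)) := by
  refine isUnit_of_vecMul fun v hv => ?_
  rw [matCHat22, vecMul_sub, vecMul_one, sub_eq_zero] at hv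
  set f := ∑ i, v i • Phi2Poly α V b d n i with hf
  set g := ∑ i, v i • h.projEps n (Phi2Poly α V b d n i) with hg
  set e := ∑ j, (v ᵥ* (matC α V b d n (fromBlocks 0 aᵀ a 0)).toBlocks₂₁) j •
    Phi1Poly α V b d n j with he'
  have hgm : g ∈ degreeLT ℝ n :=
    Submodule.sum_mem _ fun i _ => Submodule.smul_mem _ _ (h.projEps_mem _)
  have hem : e ∈ degreeLT ℝ n :=
    Submodule.sum_mem _ fun i _ => Submodule.smul_mem _ _ (h.Phi1Poly_mem hn i)
  have hdg : polyDeriv α V g = X * e + f := by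
    simp only [hg, hf, he', map_sum, map_smul, h.polyDeriv_projEps_Phi2 hn ha, smul_add,
      Finset.sum_add_distrib, sum_smul_sum_smul, ← hv, mul_smul_comm, Finset.mul_sum]
  have hmom : ∀ r ∈ degreeLT ℝ n, h.moment (X * (g * r)) = h.epsForm f (X * r) := fun r hr => by
    simp only [hg, hf, Finset.sum_mul, Finset.mul_sum, smul_mul_assoc, mul_smul_comm, map_sum,
      map_smul, LinearMap.sum_apply, LinearMap.smul_apply, h.moment_projEps_mul _ hr]
  have he0 : e = 0 := h.eq_zero_of_epsForm he hem fun r hr => by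
    have h1 := h.epsForm_polyDeriv g (X * r)
    rw [hdg, map_add, LinearMap.add_apply, mul_left_comm, hmom r hr] at h1
    linarith
  rw [he0, mul_zero, zero_add] at hdg
  have hg0 : g = 0 := h.eq_zero_of_moment_polyDeriv he hgm fun r hr => by
    rw [hdg, hf, Finset.sum_mul, map_sum]
    exact Finset.sum_eq_zero fun j _ => by
      rw [smul_mul_assoc, map_smul, h.moment_Phi2Poly_mul j hr, smul_zero]
  rw [hg0, map_zero] at hdg
  exact h.sum_Phi2Poly_eq_zero hb hd hn hdg.symm

/-! ### The matrices `G₁₁` and `Ĝ₁₁` -/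

theorem Admissible.matB_blocks_transpose (h : Admissible α V) (hn : n ≠ 0) :
    ((matB α V b d n).toBlocks₁₁)ᵀ = -(matB α V b d n).toBlocks₁₁ ∧
    ((matB α V b d n).toBlocks₁₂)ᵀ = -(matB α V b d n).toBlocks₂₁ ∧
    ((matB α V b d n).toBlocks₂₁)ᵀ = -(matB α V b d n).toBlocks₁₂ ∧
    ((matB α V b d n).toBlocks₂₂)ᵀ = -(matB α V b d n).toBlocks₂₂ := by
  have h1 : ∀ i j, matB α V b d n j i = -matB α V b d n i j := fun i j =>
    congrFun (congrFun (h.matB_transpose hn) i) j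
  refine ⟨?_, ?_, ?_, ?_⟩ <;> ext i j <;> exact h1 _ _

/-- With $C_{12}=B_{11}A_{12}$ and $B^t=-B$, the block relation becomes
$C_{11}B_{11}=B_{11}C_{11}^t$. Therefore $G_{11}=A_{21}(C_{11}^{-1}B_{11})A_{12}$ with
$C_{11}^{-1}B_{11}=B_{11}C_{11}^{-t}$ skew. -/
theorem Admissible.matG11_transpose (h : Admissible α V) (hn : n ≠ 0)
    (ha : IsCommutatorBlock α V b d n a)
    (hu : IsUnit (matC α V b d n (fromBlocks 0 aᵀ a 0)).toBlocks₁₁) :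
    (matG11 α V b d n (fromBlocks 0 aᵀ a 0))ᵀ = -matG11 α V b d n (fromBlocks 0 aᵀ a 0) := by
  have hbl := h.blocks₁₁_eq hn ha
  obtain ⟨t1, t2, -, -⟩ := h.matB_blocks_transpose (b := b) (d := d) hn
  rw [matG11]
  rw [matC_eq] at hu hbl ⊢
  simp only [toBlocks_fromBlocks₁₁, toBlocks_fromBlocks₁₂, toBlocks_fromBlocks₂₁] at hu hbl ⊢
  set B := matB α V b d n
  have hcomm : (1 + B.toBlocks₁₂ * a) * B.toBlocks₁₁ =
      B.toBlocks₁₁ * (1 + B.toBlocks₁₂ * a)ᵀ := by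
    rw [transpose_add, transpose_mul, t2, transpose_one, Matrix.mul_add, Matrix.mul_one,
      Matrix.mul_neg, Matrix.mul_neg, ← Matrix.mul_assoc]
    exact eq_sub_of_add_eq hbl |>.trans (sub_eq_add_neg _ _)
  have hinv := inv_mul_eq_mul_inv hu ((isUnit_transpose _).2 hu) hcomm
  conv_rhs => rw [Matrix.mul_assoc a, ← Matrix.mul_assoc _ B.toBlocks₁₁, hinv]
  rw [transpose_mul, transpose_mul, transpose_mul, transpose_transpose, t1, transpose_nonsing_inv]
  simp only [Matrix.mul_neg, Matrix.neg_mul, Matrix.mul_assoc]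

/-- Here the block relation becomes $\widehat C_{22}B_{22}=B_{22}\widehat C_{22}^t$, so the inverse
can be moved across $B_{22}$, and $B_{22}A_{21}=C_{21}$. -/
theorem Admissible.matGHat11_eq (h : Admissible α V) (hn : n ≠ 0)
    (ha : IsCommutatorBlock α V b d n a)
    (hu : IsUnit (matCHat22 α V b d n (fromBlocks 0 aᵀ a 0))) :
    matGHat11 α V b d n (fromBlocks 0 aᵀ a 0) =
      -(aᵀ * (matCHat22 α V b d n (fromBlocks 0 aᵀ a 0))⁻¹
        * (matC α V b d n (fromBlocks 0 aᵀ a 0)).toBlocks₂₁) := by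
  have hbl := h.blocks₂₂_eq hn ha
  obtain ⟨-, -, t3, -⟩ := h.matB_blocks_transpose (b := b) (d := d) hn
  rw [matGHat11]
  rw [matCHat22] at hu ⊢
  rw [matC_eq] at hu hbl ⊢
  simp only [toBlocks_fromBlocks₁₂, toBlocks_fromBlocks₂₁, toBlocks_fromBlocks₂₂] at hu hbl ⊢
  set B := matB α V b d n
  have hcomm : (1 - B.toBlocks₂₁ * aᵀ) * B.toBlocks₂₂ =
      B.toBlocks₂₂ * (1 - B.toBlocks₂₁ * aᵀ)ᵀ := by
    rw [transpose_sub, transpose_mul, t3, transpose_one, Matrix.mul_sub, Matrix.mul_one,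
      transpose_transpose, Matrix.mul_neg, Matrix.mul_neg, sub_neg_eq_add, Matrix.sub_mul,
      Matrix.one_mul, ← Matrix.mul_assoc, sub_eq_add_neg, eq_neg_of_add_eq_zero_left hbl]
  have hinv := inv_mul_eq_mul_inv hu ((isUnit_transpose _).2 hu) hcomm
  rw [transpose_nonsing_inv, Matrix.mul_assoc aᵀ, ← hinv]
  simp only [Matrix.mul_assoc]

/-- Transposition turns the defining expression into the other one, up to the sign from
$B_{22}^t=-B_{22}$. -/
theorem Admissible.matGHat11_transpose (h : Admissible α V) (hn : n ≠ 0)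
    (ha : IsCommutatorBlock α V b d n a)
    (hu : IsUnit (matCHat22 α V b d n (fromBlocks 0 aᵀ a 0))) :
    (matGHat11 α V b d n (fromBlocks 0 aᵀ a 0))ᵀ =
      -matGHat11 α V b d n (fromBlocks 0 aᵀ a 0) := by
  obtain ⟨-, -, -, t4⟩ := h.matB_blocks_transpose (b := b) (d := d) hn
  conv_rhs => rw [h.matGHat11_eq hn ha hu, matC_eq]
  rw [matGHat11]
  simp only [toBlocks_fromBlocks₁₂, toBlocks_fromBlocks₂₁, transpose_neg, transpose_mul,
    transpose_transpose, t4, Matrix.mul_neg, Matrix.neg_mul, Matrix.mul_assoc]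

/-! ### The kernels -/

theorem Admissible.phi_eq (k : ℕ) {x : ℝ} (hx : 0 < x) :
    phi α V k x = withWeightDivL α V x (X * orthoPoly α V k) :=
  withWeight_eq hx.ne' _

theorem Admissible.matM4_apply (h : Admissible α V) (r : ℕ → ℝ[X]) (N : ℕ) (j k : Fin (2 * N)) :
    matM4 α V r N j k = h.moment (r j * polyDeriv α V (r k)) := by
  rw [← h.ip_withWeight]
  exact ip_congr (fun _ _ => rfl) fun x hx => (hasDerivAt_withWeight _ hx).deriv

theorem Admissible.matM1_apply (h : Admissible α V) (r : ℕ → ℝ[X]) (j k : Fin n) :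
    matM1 α V r n j k = h.epsForm (X * r k) (X * r j) := by
  rw [h.epsForm_apply, matM1, of_apply, ip_comm]
  refine ip_congr (fun x _ => ?_) fun x hx => withWeight_eq hx.ne' _
  exact congrFun (eps_congr fun y hy => withWeight_eq hy.ne' _) x

theorem Admissible.isUnit_matM4 (h : Admissible α V) {r : ℕ → ℝ[X]}
    (hr : ∀ k, (r k).degree = k) (N : ℕ) : IsUnit (matM4 α V r N) := by
  refine isUnit_of_mulVec fun v hv => sum_degree_seq_eq_zero hr
    (h.eq_zero_of_moment_polyDeriv (even_two_mul N) (Submodule.sum_mem _ fun k _ =>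
      Submodule.smul_mem _ _ (degree_seq_mem_degreeLT hr k.2)) fun s hs => ?_)
  refine map_eq_zero_of_degree_seq hr (f := h.moment ∘ₗ LinearMap.mulLeft ℝ _) (fun j hj => ?_) hs
  have h1 := congrFun hv ⟨j, hj⟩
  simp only [mulVec, dotProduct, h.matM4_apply, Pi.zero_apply] at h1
  rw [LinearMap.comp_apply, LinearMap.mulLeft_apply, map_sum, Finset.sum_mul, map_sum, ← h1]
  refine Finset.sum_congr rfl fun k _ => ?_
  rw [map_smul, smul_mul_assoc, map_smul, smul_eq_mul, mul_comm (v k), mul_comm (r j)]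

theorem Admissible.isUnit_matM1 (h : Admissible α V) {r : ℕ → ℝ[X]}
    (hr : ∀ k, (r k).degree = k) (he : Even n) : IsUnit (matM1 α V r n) := by
  refine isUnit_of_mulVec fun v hv => sum_degree_seq_eq_zero hr
    (h.eq_zero_of_epsForm he (Submodule.sum_mem _ fun k _ =>
      Submodule.smul_mem _ _ (degree_seq_mem_degreeLT hr k.2)) fun s hs => ?_)
  refine map_eq_zero_of_degree_seq hr (f := h.epsForm _ ∘ₗ LinearMap.mulLeft ℝ X)
    (fun j hj => ?_) hs
  have h1 := congrFun hv ⟨j, hj⟩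
  simp only [mulVec, dotProduct, h.matM1_apply, Pi.zero_apply] at h1
  rw [LinearMap.comp_apply, LinearMap.mulLeft_apply, Finset.mul_sum, map_sum, LinearMap.sum_apply,
    ← h1]
  refine Finset.sum_congr rfl fun k _ => ?_
  rw [mul_smul_comm, map_smul, LinearMap.smul_apply, smul_eq_mul, mul_comm (v k)]

/-- A polynomial `s` of degree `< n` is determined by the functional
`q ↦ ⟨(q √w)', s √w⟩` on polynomials of degree `< n`. -/
theorem Admissible.eq_of_moment_polyDeriv (h : Admissible α V) (he : Even n) {s t : ℝ[X]}
    (hs : s ∈ degreeLT ℝ n) (ht : t ∈ degreeLT ℝ n)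
    (hst : ∀ q ∈ degreeLT ℝ n, h.moment (polyDeriv α V q * s) = h.moment (polyDeriv α V q * t)) :
    s = t := by
  refine sub_eq_zero.1 (h.eq_zero_of_moment_polyDeriv he (Submodule.sub_mem _ hs ht) fun q hq => ?_)
  rw [h.moment_polyDeriv_antisymm, mul_sub, map_sub, hst q hq, sub_self, neg_zero]

/-- A polynomial `s` of degree `< n` is determined by the functional
`q ↦ ⟨ε (s √w), q √w⟩` on polynomials of degree `< n`. -/
theorem Admissible.eq_of_epsForm (h : Admissible α V) (he : Even n) {s t : ℝ[X]}
    (hs : s ∈ degreeLT ℝ n) (ht : t ∈ degreeLT ℝ n)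
    (hst : ∀ q ∈ degreeLT ℝ n, h.epsForm (X * s) (X * q) = h.epsForm (X * t) (X * q)) :
    s = t := by
  refine sub_eq_zero.1 (h.eq_zero_of_epsForm he (Submodule.sub_mem _ hs ht) fun q hq => ?_)
  rw [mul_sub, map_sub, LinearMap.sub_apply, hst q hq, sub_self]

/-- The polynomial `s` with `S_{N,4}(x, ·) = s √w`. -/
def kernelS4Poly (α : ℝ) (V : ℝ[X]) (r : ℕ → ℝ[X]) (N : ℕ) (x : ℝ) : ℝ[X] :=
  ∑ k, ((fun j : Fin (2 * N) => withWeightDiv α V (polyDeriv α V (r j)) x) ᵥ*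
    (matM4 α V r N)⁻¹) k • r k

/-- The polynomial `s` with `S_{n,1}(x, ·) = ε (s √w)`. -/
def kernelS1Poly (α : ℝ) (V : ℝ[X]) (r : ℕ → ℝ[X]) (n : ℕ) (x : ℝ) : ℝ[X] :=
  -∑ k, ((fun j : Fin n => withWeight α V (r j) x) ᵥ* (matM1 α V r n)⁻¹) k • r k

theorem kernelS4_eq (r : ℕ → ℝ[X]) (N : ℕ) {x y : ℝ} (hx : 0 < x) (hy : 0 < y) :
    kernelS4 α V r N x y = withWeight α V (kernelS4Poly α V r N x) y := by
  rw [withWeight_eq hy.ne', ← withWeightDivL_apply, kernelS4Poly, Finset.mul_sum, map_sum, kernelS4,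
    Finset.sum_comm]
  refine Finset.sum_congr rfl fun k _ => ?_
  rw [mul_smul_comm, map_smul, withWeightDivL_apply, ← withWeight_eq hy.ne', smul_eq_mul, vecMul,
    dotProduct, Finset.sum_mul]
  exact Finset.sum_congr rfl fun j _ => by rw [(hasDerivAt_withWeight _ hx).deriv]

theorem Admissible.kernelS1_eq (h : Admissible α V) (r : ℕ → ℝ[X]) (x y : ℝ) :
    kernelS1 α V r n x y = h.epsL y (X * kernelS1Poly α V r n x) := by
  rw [kernelS1Poly, mul_neg, map_neg, Finset.mul_sum, map_sum, kernelS1, Finset.sum_comm]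
  congr 1
  refine Finset.sum_congr rfl fun k _ => ?_
  rw [mul_smul_comm, map_smul, h.epsL_apply, smul_eq_mul, vecMul,
    dotProduct, Finset.sum_mul]
  refine Finset.sum_congr rfl fun j _ => ?_
  rw [eps_congr fun z hz => withWeight_eq (ne_of_gt hz) _]

theorem kernelS4Poly_mem {r : ℕ → ℝ[X]} (hr : ∀ k, (r k).degree = k) (N : ℕ) (x : ℝ) :
    kernelS4Poly α V r N x ∈ degreeLT ℝ (2 * N) :=
  Submodule.sum_mem _ fun k _ => Submodule.smul_mem _ _ (degree_seq_mem_degreeLT hr k.2)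

theorem kernelS1Poly_mem {r : ℕ → ℝ[X]} (hr : ∀ k, (r k).degree = k) (x : ℝ) :
    kernelS1Poly α V r n x ∈ degreeLT ℝ n :=
  Submodule.neg_mem _ (Submodule.sum_mem _ fun k _ =>
    Submodule.smul_mem _ _ (degree_seq_mem_degreeLT hr k.2))

/-- The inverse of `matM4` is there to make $S_{N,4}(x,\cdot)$ reproduce derivatives:
$\langle(q\sqrt w)',S_{N,4}(x,\cdot)\rangle=(q\sqrt w)'(x)$. By nondegeneracy this property
determines the kernel. -/
theorem Admissible.moment_kernelS4Poly (h : Admissible α V) {r : ℕ → ℝ[X]}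
    (hr : ∀ k, (r k).degree = k) (N : ℕ) (x : ℝ) {q : ℝ[X]} (hq : q ∈ degreeLT ℝ (2 * N)) :
    h.moment (polyDeriv α V q * kernelS4Poly α V r N x) =
      withWeightDiv α V (polyDeriv α V q) x := by
  rw [← sub_eq_zero]
  refine map_eq_zero_of_degree_seq hr (f := h.moment ∘ₗ LinearMap.mulRight ℝ _ ∘ₗ polyDeriv α V -
    withWeightDivL α V x ∘ₗ polyDeriv α V) (fun l hl => ?_) hq
  have hdet := (isUnit_iff_isUnit_det _).1 (h.isUnit_matM4 hr N)
  rw [LinearMap.sub_apply, sub_eq_zero]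
  change h.moment (polyDeriv α V (r l) * kernelS4Poly α V r N x) = withWeightDiv α V _ x
  set v := fun j : Fin (2 * N) => withWeightDiv α V (polyDeriv α V (r j)) x with hv
  have h1 : h.moment (polyDeriv α V (r l) * kernelS4Poly α V r N x) =
      (v ᵥ* (matM4 α V r N)⁻¹ ᵥ* matM4 α V r N) ⟨l, hl⟩ := by
    rw [kernelS4Poly, Finset.mul_sum, map_sum, vecMul, dotProduct]
    refine Finset.sum_congr rfl fun k _ => ?_
    rw [mul_smul_comm, map_smul, smul_eq_mul, h.matM4_apply, mul_comm (polyDeriv α V _)]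
  rw [h1, vecMul_vecMul, nonsing_inv_mul _ hdet, vecMul_one]

theorem Admissible.epsForm_kernelS1Poly (h : Admissible α V) {r : ℕ → ℝ[X]}
    (hr : ∀ k, (r k).degree = k) (he : Even n) {x : ℝ} (hx : 0 < x) {q : ℝ[X]}
    (hq : q ∈ degreeLT ℝ n) :
    h.epsForm (X * kernelS1Poly α V r n x) (X * q) = withWeight α V q x := by
  rw [← sub_eq_zero, withWeight_eq hx.ne']
  refine map_eq_zero_of_degree_seq hr (f := h.epsForm (X * kernelS1Poly α V r n x) ∘ₗ
    LinearMap.mulLeft ℝ X - withWeightDivL α V x ∘ₗ LinearMap.mulLeft ℝ X) (fun l hl => ?_) hq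
  have hdet := (isUnit_iff_isUnit_det _).1 (h.isUnit_matM1 hr he)
  rw [LinearMap.sub_apply, sub_eq_zero]
  change h.epsForm (X * kernelS1Poly α V r n x) (X * r l) = withWeightDiv α V (X * r l) x
  rw [← withWeight_eq hx.ne']
  set v := fun j : Fin n => withWeight α V (r j) x with hv
  have h1 : h.epsForm (X * kernelS1Poly α V r n x) (X * r l) =
      (v ᵥ* (matM1 α V r n)⁻¹ ᵥ* matM1 α V r n) ⟨l, hl⟩ := by
    rw [kernelS1Poly, mul_neg, map_neg, Finset.mul_sum, map_sum, vecMul, dotProduct,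
      LinearMap.neg_apply, LinearMap.sum_apply, ← Finset.sum_neg_distrib]
    refine Finset.sum_congr rfl fun k _ => ?_
    rw [mul_smul_comm, map_smul, LinearMap.smul_apply, smul_eq_mul, h.matM1_apply,
      h.epsForm_antisymm (X * r k), mul_neg, neg_neg]
  rw [h1, vecMul_vecMul, nonsing_inv_mul _ hdet, vecMul_one]

/-- The candidate for $S(x,\cdot)$ is $K_n(x,\cdot)-\Phi_2(x)A_{21}C_{11}^{-1}K\varepsilon\Phi_1^t$,
which lies in the range of $K$. For $u=q\sqrt w$ in that range, the commutator gives
$u'-Ku'=\Phi_2A_{21}\langle u,\Phi_1^t\rangle$, and $\langle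
u',K\varepsilon\Phi_1^t\rangle=-C_{11}\langle u,\Phi_1^t\rangle$, so the second term supplies
exactly what $K_n$ misses. -/
theorem Admissible.kernelS4_formula (h : Admissible α V) {N : ℕ} (hn : 2 * N ≠ 0)
    (ha : IsCommutatorBlock α V b d (2 * N) a)
    (hu : IsUnit (matC α V b d (2 * N) (fromBlocks 0 aᵀ a 0)).toBlocks₁₁) {r : ℕ → ℝ[X]}
    (hr : ∀ k, (r k).degree = k) {x y : ℝ} (hx : 0 < x) (hy : 0 < y) :
    kernelS4 α V r N x y = kernelK α V (2 * N) x y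
      - sandwich (Phi2 α V b d (2 * N)) a (Phi1 α V b d (2 * N)) x y
      - sandwich (Phi2 α V b d (2 * N)) (matG11 α V b d (2 * N) (fromBlocks 0 aᵀ a 0))
          (Phi2 α V b d (2 * N)) x y := by
  set n := 2 * N with hnN
  set A := fromBlocks 0 aᵀ a 0 with hA
  set C₁ := (matC α V b d n A).toBlocks₁₁ with hC₁
  set C₂ := (matC α V b d n A).toBlocks₁₂ with hC₂
  have hdet := (isUnit_iff_isUnit_det _).1 hu
  set f : Fin V.natDegree → ℝ := fun i => Phi2 α V b d n i x with hf
  have hfx : ∀ i, f i = withWeightDivL α V x (Phi2Poly α V b d n i) := fun i =>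
    h.Phi2_eq hn i hx.ne'
  set κ : Fin V.natDegree → ℝ[X] := fun i => h.projEps n (X * Phi1Poly α V b d n i) with hκ
  have hdκ : ∀ i, polyDeriv α V (κ i) = ∑ j, C₁ i j • (X * Phi1Poly α V b d n j)
      + ∑ j, C₂ i j • Phi2Poly α V b d n j := h.polyDeriv_projEps_Phi1 hn ha
  set s : ℝ[X] := ∑ k ∈ Finset.range n, phi α V k x • orthoPoly α V k
    - ∑ j, (f ᵥ* (a * C₁⁻¹)) j • κ j with hs
  have hsm : s ∈ degreeLT ℝ n := Submodule.sub_mem _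
    (Submodule.sum_mem _ fun k hk => Submodule.smul_mem _ _
      (h.orthoPoly_mem (Finset.mem_range.1 hk)))
    (Submodule.sum_mem _ fun j _ => Submodule.smul_mem _ _ (h.projEps_mem _))
  have hseq : kernelS4Poly α V r N x = s := by
    refine h.eq_of_moment_polyDeriv (n := n) (even_two_mul N) (kernelS4Poly_mem hr N x) hsm fun q hq => ?_
    rw [h.moment_kernelS4Poly hr N x hq]
    set ℓ : Fin V.natDegree → ℝ := fun j => h.moment (q * (X * Phi1Poly α V b d n j)) with hℓ
    have hκq : (fun j => h.moment (polyDeriv α V q * κ j)) = -(C₁ *ᵥ ℓ) := by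
      ext j
      rw [h.moment_polyDeriv_antisymm, mul_comm, hdκ, mul_add, map_add, Finset.mul_sum,
        Finset.mul_sum, map_sum, map_sum, Finset.sum_eq_zero (f := fun i => h.moment (q * C₂ j i • _)),
        add_zero, Pi.neg_apply, mulVec, dotProduct]
      · simp only [mul_smul_comm, map_smul, smul_eq_mul, hℓ]
      · intro i _
        rw [mul_smul_comm, map_smul, mul_comm, h.moment_Phi2Poly_mul i hq, smul_zero]
    -- The commutator identity paired with $q\sqrt w$; the pairings with $\Phi_2$ vanish, so only
    -- the block $A_{21}$ remains.
    have hcomm := congrArg (withWeightDivL α V x) (ha (h.moment ∘ₗ LinearMap.mulLeft ℝ q))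
    have hΦ2 : (fun i => (h.moment ∘ₗ LinearMap.mulLeft ℝ q) (Phi2Poly α V b d n i)) = 0 := by
      ext i
      rw [LinearMap.comp_apply, LinearMap.mulLeft_apply, mul_comm, h.moment_Phi2Poly_mul i hq,
        Pi.zero_apply]
    have hq2 : withWeightDivL α V x (∑ k ∈ Finset.range n,
        (h.moment ∘ₗ LinearMap.mulLeft ℝ q) (X * orthoPoly α V k) •
          polyDeriv α V (orthoPoly α V k)) = withWeightDiv α V (polyDeriv α V q) x := by
      rw [← withWeightDivL_apply]
      congr 1
      conv_rhs => rw [← h.expansion hq]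
      simp only [map_sum, map_smul, LinearMap.comp_apply, LinearMap.mulLeft_apply, mul_left_comm q X]
    rw [hΦ2, zero_vecMul, Finset.sum_add_distrib, map_add, hq2] at hcomm
    simp only [Pi.zero_apply, zero_smul, Finset.sum_const_zero, add_zero] at hcomm
    have hm2 : h.moment (polyDeriv α V q * ∑ j, (f ᵥ* (a * C₁⁻¹)) j • κ j) =
        -(f ⬝ᵥ (a *ᵥ ℓ)) := by
      have := map_sum_vecMul (h.moment ∘ₗ LinearMap.mulLeft ℝ (polyDeriv α V q)) f (a * C₁⁻¹) κ
      simp only [LinearMap.comp_apply, LinearMap.mulLeft_apply] at this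
      rw [this, hκq, mulVec_neg, mulVec_mulVec, Matrix.mul_assoc, nonsing_inv_mul _ hdet,
        Matrix.mul_one, dotProduct_neg]
    have hm1 : withWeightDivL α V x (∑ k ∈ Finset.range n,
        (h.moment ∘ₗ LinearMap.mulLeft ℝ q) (polyDeriv α V (orthoPoly α V k)) •
          (X * orthoPoly α V k)) =
        -h.moment (polyDeriv α V q * ∑ k ∈ Finset.range n, phi α V k x • orthoPoly α V k) := by
      rw [map_sum, Finset.mul_sum, map_sum, ← Finset.sum_neg_distrib]
      refine Finset.sum_congr rfl fun k _ => ?_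
      rw [map_smul, LinearMap.comp_apply, LinearMap.mulLeft_apply, mul_comm q,
        h.moment_polyDeriv_antisymm, mul_smul_comm, map_smul, Admissible.phi_eq k hx]
      simp only [smul_eq_mul]
      ring
    have hr2 : withWeightDivL α V x (∑ i, (a *ᵥ fun j => (h.moment ∘ₗ LinearMap.mulLeft ℝ q)
        (X * Phi1Poly α V b d n j)) i • Phi2Poly α V b d n i) = f ⬝ᵥ (a *ᵥ ℓ) := by
      rw [map_sum, dotProduct]
      refine Finset.sum_congr rfl fun i _ => ?_
      rw [map_smul, ← hfx, smul_eq_mul, mul_comm]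
      rfl
    rw [hs, mul_sub, map_sub, hm2]
    linarith
  set e₁ : Fin V.natDegree → ℝ := fun j => eps (Phi1 α V b d n j) y with he₁
  set e₂ : Fin V.natDegree → ℝ := fun j => eps (Phi2 α V b d n j) y with he₂
  have h1 : ∀ j, e₁ j = h.epsL y (X * Phi1Poly α V b d n j) := fun j => h.eps_Phi hn (Sum.inl j) y
  have h2 : ∀ j, e₂ j = h.epsL y (Phi2Poly α V b d n j) := fun j => h.eps_Phi hn (Sum.inr j) y
  -- Since $\varepsilon D=1$ on the range of $K$, $K\varepsilon\Phi_1^t=\varepsilon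
  -- DK\varepsilon\Phi_1^t=C_{11}\varepsilon\Phi_1^t+C_{12}\varepsilon\Phi_2^t$. The factor
  -- $C_{11}^{-1}$ cancels in the first term and produces $G_{11}$ in the second.
  have hκy : (fun j => withWeightDivL α V y (X * κ j)) = C₁ *ᵥ e₁ + C₂ *ᵥ e₂ := by
    ext j
    rw [withWeightDivL_apply, ← withWeight_eq hy.ne', ← h.eps_polyDeriv _ hy, ← h.epsL_apply, hdκ,
      map_add, map_sum, map_sum]
    simp only [map_smul, smul_eq_mul, ← h1, ← h2]
    rfl
  have hK : withWeightDivL α V y (X * ∑ k ∈ Finset.range n, phi α V k x • orthoPoly α V k) =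
      kernelK α V n x y := by
    rw [Finset.mul_sum, map_sum, kernelK]
    refine Finset.sum_congr rfl fun k _ => ?_
    rw [mul_smul_comm, map_smul, smul_eq_mul, Admissible.phi_eq k hy]
  have hκs := map_sum_vecMul (withWeightDivL α V y ∘ₗ LinearMap.mulLeft ℝ X) f (a * C₁⁻¹) κ
  simp only [LinearMap.comp_apply, LinearMap.mulLeft_apply] at hκs
  rw [kernelS4_eq r N hx hy, hseq, withWeight_eq hy.ne', ← withWeightDivL_apply, hs, mul_sub, map_sub,
    hK, hκs, hκy, sandwich_eq, sandwich_eq, matG11, toBlocks_fromBlocks₂₁, sub_sub, mulVec_add,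
    mulVec_mulVec, mulVec_mulVec, Matrix.mul_assoc a _ C₁, nonsing_inv_mul _ hdet, Matrix.mul_one,
    dotProduct_add]

/-- Stripped of $\varepsilon$, the right-hand side is
$\sum_k\phi_k(x)\phi_k'-\Phi_1(x)A_{12}\Phi_2^t-\Phi_1(x)\widehat G_{11}\Phi_1^t$. It must be shown
to lie in the range of $K$ and to satisfy $\langle\varepsilon s,q\sqrt w\rangle=(q\sqrt w)(x)$. The
first sum already has this property, and $\widehat G_{11}$ makes the two corrections cancel. -/
theorem Admissible.kernelS1_formula (h : Admissible α V) (hn : n ≠ 0) (he : Even n)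
    (ha : IsCommutatorBlock α V b d n a)
    (hu : IsUnit (matCHat22 α V b d n (fromBlocks 0 aᵀ a 0))) {r : ℕ → ℝ[X]}
    (hr : ∀ k, (r k).degree = k) {x y : ℝ} (hx : 0 < x) (hy : 0 < y) :
    kernelS1 α V r n x y = kernelK α V n x y
      - sandwich (Phi1 α V b d n) aᵀ (Phi2 α V b d n) x y
      - sandwich (Phi1 α V b d n) (matGHat11 α V b d n (fromBlocks 0 aᵀ a 0))
          (Phi1 α V b d n) x y := by
  set A := fromBlocks 0 aᵀ a 0 with hA
  set C₁ := (matC α V b d n A).toBlocks₂₁ with hC₁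
  set C₂ := (matC α V b d n A).toBlocks₂₂ with hC₂
  set G := matGHat11 α V b d n A with hG
  have hdet := (isUnit_iff_isUnit_det _).1 hu
  set f : Fin V.natDegree → ℝ := fun i => Phi1 α V b d n i x with hf
  have hfx : (fun j => withWeightDivL α V x (X * Phi1Poly α V b d n j)) = f :=
    funext fun i => (h.Phi1_eq hn i hx.ne').symm
  -- Neither the sum of the $\phi_k'$ nor the term in $\Phi_2$ is in the range of $K$ by itself. The
  -- commutator identity replaces their difference by terms in $\Phi_1$ and the $\phi_k$, which are.
  set t : ℝ[X] := ∑ j, ((fun i => withWeightDivL α V x (Phi2Poly α V b d n i)) ᵥ* a) j •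
      Phi1Poly α V b d n j
    - ∑ k ∈ Finset.range n,
      withWeightDivL α V x (polyDeriv α V (orthoPoly α V k)) • orthoPoly α V k
    - ∑ j, (f ᵥ* G) j • Phi1Poly α V b d n j with ht
  have htm : t ∈ degreeLT ℝ n := Submodule.sub_mem _ (Submodule.sub_mem _
      (Submodule.sum_mem _ fun j _ => Submodule.smul_mem _ _ (h.Phi1Poly_mem hn j))
      (Submodule.sum_mem _ fun k hk => Submodule.smul_mem _ _
        (h.orthoPoly_mem (Finset.mem_range.1 hk))))
    (Submodule.sum_mem _ fun j _ => Submodule.smul_mem _ _ (h.Phi1Poly_mem hn j))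
  have hXt : X * t = ∑ k ∈ Finset.range n, phi α V k x • polyDeriv α V (orthoPoly α V k)
      - ∑ i, (f ᵥ* aᵀ) i • Phi2Poly α V b d n i
      - ∑ j, (f ᵥ* G) j • (X * Phi1Poly α V b d n j) := by
    have hcomm := ha (withWeightDivL α V x)
    rw [hfx, Finset.sum_add_distrib] at hcomm
    simp only [← Admissible.phi_eq _ hx] at hcomm
    rw [ht, mul_sub, mul_sub, Finset.mul_sum, Finset.mul_sum, Finset.mul_sum, vecMul_transpose]
    simp only [mul_smul_comm]
    rw [← eq_sub_iff_add_eq] at hcomm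
    rw [hcomm]
    abel
  have hX : ∀ c : ℝ[X] →ₗ[ℝ] ℝ, c (X * t) =
      c (∑ k ∈ Finset.range n, phi α V k x • polyDeriv α V (orthoPoly α V k))
      - f ⬝ᵥ (aᵀ *ᵥ fun i => c (Phi2Poly α V b d n i))
      - f ⬝ᵥ (G *ᵥ fun j => c (X * Phi1Poly α V b d n j)) := fun c => by
    rw [hXt, map_sub, map_sub, map_sum_vecMul, map_sum_vecMul]
  have hteq : kernelS1Poly α V r n x = t := by
    refine h.eq_of_epsForm he (kernelS1Poly_mem hr x) htm fun q hq => ?_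
    rw [h.epsForm_kernelS1Poly hr he hx hq]
    have h1 := hX (h.epsForm.flip (X * q))
    simp only [LinearMap.flip_apply] at h1
    set ℓ₁ : Fin V.natDegree → ℝ := fun j => h.epsForm (X * Phi1Poly α V b d n j) (X * q) with hℓ₁
    set ℓ₂ : Fin V.natDegree → ℝ := fun j => h.epsForm (Phi2Poly α V b d n j) (X * q) with hℓ₂
    -- On the range of $K$, pairing with $\varepsilon\Phi_2^t$ is the same as pairing with
    -- $K\varepsilon\Phi_2^t=\varepsilon DK\varepsilon\Phi_2^t$. Solving for `ℓ₂` is what calls for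
    -- the inverse of $\widehat C_{22}$.
    have hℓ : ℓ₂ = C₁ *ᵥ ℓ₁ + C₂ *ᵥ ℓ₂ := by
      ext i
      have h2 := h.epsForm_polyDeriv (h.projEps n (Phi2Poly α V b d n i)) (X * q)
      rw [mul_left_comm, h.moment_projEps_mul _ hq, h.polyDeriv_projEps_Phi2 hn ha] at h2
      simp only [map_add, map_sum, map_smul, LinearMap.add_apply, LinearMap.sum_apply,
        LinearMap.smul_apply, smul_eq_mul] at h2
      exact h2.symm
    have hℓ' : matCHat22 α V b d n A *ᵥ ℓ₂ = C₁ *ᵥ ℓ₁ := by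
      rw [matCHat22, sub_mulVec, one_mulVec, sub_eq_iff_eq_add]
      exact hℓ
    have hℓ₂' : ℓ₂ = (matCHat22 α V b d n A)⁻¹ *ᵥ (C₁ *ᵥ ℓ₁) := by
      rw [← hℓ', mulVec_mulVec, nonsing_inv_mul _ hdet, one_mulVec]
    rw [h1, hG, h.matGHat11_eq hn ha hu, hℓ₂', neg_mulVec, dotProduct_neg, mulVec_mulVec,
      mulVec_mulVec, sub_neg_eq_add, sub_add_cancel, map_sum, LinearMap.sum_apply]
    conv_lhs => rw [← h.expansion hq, withWeight_eq hx.ne', ← withWeightDivL_apply, Finset.mul_sum,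
      map_sum]
    refine Finset.sum_congr rfl fun k _ => ?_
    rw [mul_smul_comm, map_smul, map_smul, LinearMap.smul_apply, h.epsForm_polyDeriv,
      Admissible.phi_eq k hx, smul_eq_mul, smul_eq_mul, mul_comm, mul_left_comm (orthoPoly α V k) X,
      mul_comm q]
  rw [h.kernelS1_eq, hteq, hX, sandwich_eq, sandwich_eq]
  have h1 : ∀ j, eps (Phi1 α V b d n j) y = h.epsL y (X * Phi1Poly α V b d n j) :=
    fun j => h.eps_Phi hn (Sum.inl j) y
  have h2 : ∀ j, eps (Phi2 α V b d n j) y = h.epsL y (Phi2Poly α V b d n j) :=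
    fun j => h.eps_Phi hn (Sum.inr j) y
  simp only [h1, h2]
  congr 2
  rw [map_sum, kernelK]
  refine Finset.sum_congr rfl fun k _ => ?_
  rw [map_smul, h.epsL_apply, h.eps_polyDeriv _ hy]
  rfl

end

end

end LaguerreWidom

theorem lemma2p9 (α : ℝ) (hα : 0 < α) (V : Polynomial ℝ) (hm : 0 < V.natDegree)
    (hV : 0 < V.leadingCoeff) (n : ℕ) (hn : Even n) (hmn : V.natDegree ≤ n)
    (b d : ℝ) (hb : 0 < b) (hd : d < 0) :
    (∃! A : LaguerreWidom.BlockMat V.natDegree, LaguerreWidom.IsCommutatorMatrix α V b d n A) ∧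
    ∀ A : LaguerreWidom.BlockMat V.natDegree, LaguerreWidom.IsCommutatorMatrix α V b d n A →
      -- the structure of `A`, and the inverses that occur below exist
      (A.toBlocks₁₁ = 0 ∧ A.toBlocks₂₂ = 0 ∧ A.toBlocks₁₂ = A.toBlocks₂₁.transpose ∧
        IsUnit (LaguerreWidom.matC α V b d n A).toBlocks₁₁ ∧
        IsUnit (LaguerreWidom.matCHat22 α V b d n A)) ∧
      -- (i), for every choice of the polynomials `r_k` that represent the kernels
      (∀ r : ℕ → Polynomial ℝ, (∀ k, (r k).degree = k) →
        IsUnit (LaguerreWidom.matM1 α V r n) ∧ IsUnit (LaguerreWidom.matM4 α V r (n / 2)) ∧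
        ∀ x y : ℝ, 0 < x → 0 < y →
          LaguerreWidom.kernelS4 α V r (n / 2) x y =
            LaguerreWidom.kernelK α V n x y
              - LaguerreWidom.sandwich (LaguerreWidom.Phi2 α V b d n) A.toBlocks₂₁
                  (LaguerreWidom.Phi1 α V b d n) x y
              - LaguerreWidom.sandwich (LaguerreWidom.Phi2 α V b d n)
                  (LaguerreWidom.matG11 α V b d n A) (LaguerreWidom.Phi2 α V b d n) x y ∧
          LaguerreWidom.kernelS1 α V r n x y =
            LaguerreWidom.kernelK α V n x y
              - LaguerreWidom.sandwich (LaguerreWidom.Phi1 α V b d n) A.toBlocks₁₂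
                  (LaguerreWidom.Phi2 α V b d n) x y
              - LaguerreWidom.sandwich (LaguerreWidom.Phi1 α V b d n)
                  (LaguerreWidom.matGHat11 α V b d n A) (LaguerreWidom.Phi1 α V b d n) x y) ∧
      -- (ii)
      (LaguerreWidom.matG11 α V b d n A).transpose = -LaguerreWidom.matG11 α V b d n A ∧
      (LaguerreWidom.matGHat11 α V b d n A).transpose = -LaguerreWidom.matGHat11 α V b d n A ∧
      LaguerreWidom.matGHat11 α V b d n A =
        -(A.toBlocks₁₂ * (LaguerreWidom.matCHat22 α V b d n A)⁻¹
          * (LaguerreWidom.matC α V b d n A).toBlocks₂₁) := by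
  have h : LaguerreWidom.Admissible α V := ⟨hα, hm, hV⟩
  have hn0 : n ≠ 0 := by omega
  obtain ⟨a, ha⟩ := h.exists_isCommutatorBlock (n := n) hb hd.ne hn0
  have hA := h.isCommutatorMatrix hn0 ha
  refine ⟨⟨_, hA, fun A' hA' => h.isCommutatorMatrix_unique hb hd.ne hn0 hmn hA' hA⟩,
    fun A hA' => ?_⟩
  -- Uniqueness reduces every assertion about `A` to the block matrix already constructed.
  obtain rfl := h.isCommutatorMatrix_unique hb hd.ne hn0 hmn hA' hA
  have hC := h.isUnit_matC₁₁ hb hd.ne hn0 hmn hn ha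
  have hĈ := h.isUnit_matCHat₂₂ hb hd.ne hn0 hn ha
  refine ⟨⟨?_, ?_, ?_, hC, hĈ⟩, fun r hr => ⟨h.isUnit_matM1 hr hn, h.isUnit_matM4 hr _,
    fun x y hx hy => ⟨?_, ?_⟩⟩, h.matG11_transpose hn0 ha hC, h.matGHat11_transpose hn0 ha hĈ, ?_⟩
  · exact Matrix.toBlocks_fromBlocks₁₁ _ _ _ _
  · exact Matrix.toBlocks_fromBlocks₂₂ _ _ _ _
  · rw [Matrix.toBlocks_fromBlocks₁₂, Matrix.toBlocks_fromBlocks₂₁]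
  · obtain ⟨N, rfl⟩ := hn.two_dvd
    rw [Nat.mul_div_cancel_left N two_pos, Matrix.toBlocks_fromBlocks₂₁]
    exact h.kernelS4_formula hn0 ha hC hr hx hy
  · rw [Matrix.toBlocks_fromBlocks₁₂]
    exact h.kernelS1_formula hn0 hn ha hĈ hr hx hy
  · rw [Matrix.toBlocks_fromBlocks₁₂]
    exact h.matGHat11_eq hn0 ha hĈ
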